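/- Theorem (Solution to the maximization problem). A (bivariate) copula is a function $C\colon[0,1]^2\to[0,1]$ with $C(u,0)=0=C(0,u)$ and $C(u,1)=u=C(1,u)$ for all $u$, and $C(u,v)+C(u',v')-C(u,v')-C(u',v)\ge 0$ whenever $u\le u'$, $v\le v'$. For a copula $C$ put $$\rho(C)=12\int_{[0,1]^2}C\,d\lambda^2-3,\qquad \xi(C)=6\int_0^1\!\int_0^1(\partial_1C(t,v))^2\,dt\,dv-2 .$$ For $c\in[0,1]$ consider the problem $$(\ast)_c\qquad \text{maximize } \rho(C)\ \text{ over all copulas } C \text{ with } \xi(C)=c .$$ For $b>0$ and $v\in[0,1]$ let $$s_v=\begin{cases}\sqrt{2v/b}, & (b\ge1,\ v\le\frac1{2b})\text{ or }(b\le1,\ v\le\frac b2),\\ v+\frac1{2b}, & \frac1{2b}<v\le1-\frac1{2b},\\ \frac vb+\frac12, & \frac b2<v\le1-\frac b2,\\ 1+\frac1b-\sqrt{2(1-v)/b}, & (b\ge1,\ v>1-\frac1{2b})\text{ or }(b\le1,\ v>1-\frac b2),\end{cases}$$ let $a_v=\max\{s_v-\frac1b,0\}$, and for $u,v\in[0,1]$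 $$C_b(u,v)=\begin{cases}u, & 0\le u\le a_v,\\ a_v+b\bigl(s_v(u-a_v)+\tfrac{a_v^2-u^2}{2}\bigr), & a_v<u\le s_v,\\ v, & s_v<u\le1.\end{cases}$$ For $x\in(0,1)$ let $$b_x=\begin{cases}\dfrac{\sqrt{6x}}{2\cos\left(\frac13\arccos\left(-\frac{3\sqrt{6x}}5\right)\right)}, & 0<x\le\frac3{10},\\[2ex] \dfrac{5+\sqrt{5(6x-1)}}{10(1-x)}, & \frac3{10}<x<1,\end{cases}\qquad M_x=\begin{cases} b_x-\frac{3b_x^2}{10}, & 0<x\le\frac3{10},\\ 1-\frac1{2b_x^2}+\frac1{5b_x^3}, & \frac3{10}<x<1,\end{cases}$$ and $M_0=0$, $M_1=1$. Write $\Pi(u,v)=uv$ and $M(u,v)=\min\{u,v\}$. For every $b>0$, the function $C_b$ is a copula; it is stochastically increasing (for $(U_1,U_2)\sim C_b$ and every $v$, $u\mapsto P(U_2\ge v\mid U_1=u)$ is increasing outside a Lebesgue null set), and for all $t,v\in[0,1]$, $\partial_1C_b(t,v)=\min\{\max\{b(s_v-t),0\},1\}$ (one-sided derivatives at $t=0,1$).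 Moreover: (i) If $c\in(0,1)$, then $b_c>0$ and $C_{b_c}$ is the unique solution of $(\ast)_c$; in particular $\xi(C_{b_c})=c$, and $\rho(C_{b_c})=M_c$. (ii) $\Pi$ is the unique solution of $(\ast)_0$, $\rho(\Pi)=M_0$, and $C_b\to\Pi$ uniformly on $[0,1]^2$ as $b\downarrow0$. (iii) $M$ is the unique solution of $(\ast)_1$, $\rho(M)=M_1$, and $C_b\to M$ uniformly on $[0,1]^2$ as $b\to\infty$. -/

import Mathlib

open MeasureTheory Filter Topology Set unitInterval

noncomputable section

namespace XiRho

/-- A bivariate copula on the closed unit square: a function with values in `[0,1]` that is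
grounded, has uniform marginals and is two-increasing. -/
structure IsCopula (C : I × I → ℝ) : Prop where
  mem_Icc : ∀ p, C p ∈ Icc (0 : ℝ) 1
  grounded_left : ∀ v, C (0, v) = 0
  grounded_right : ∀ u, C (u, 0) = 0
  marginal_left : ∀ u, C (u, 1) = u
  marginal_right : ∀ v, C (1, v) = v
  two_increasing : ∀ u u' v v', u ≤ u' → v ≤ v' →
    0 ≤ C (u, v) + C (u', v') - C (u, v') - C (u', v)

/-- The section `u ↦ C (u, v)`, extended constantly from `[0,1]` to `ℝ`, so that it can be
differentiated within `[0,1]`. -/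
def firstSection (C : I × I → ℝ) (v : I) : ℝ → ℝ :=
  IccExtend zero_le_one fun u : I => C (u, v)

/-- The partial derivative `∂₁C(t, v)` in the first argument (one-sided for `t = 0` and `t = 1`).
For a copula and fixed `v` it exists for Lebesgue almost all `t`. -/
def partialOne (C : I × I → ℝ) (t v : I) : ℝ :=
  derivWithin (firstSection C v) (Icc 0 1) t

/-- Spearman's rho, `ρ(C) = 12 ∫_{[0,1]²} C dλ² - 3`. -/
def spearmanRho (C : I × I → ℝ) : ℝ := 12 * (∫ p : I × I, C p) - 3

/-- Chatterjee's xi, `ξ(C) = 6 ∫₀¹ ∫₀¹ (∂₁C(t, v))² dt dv - 2`. -/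
def chatterjeeXi (C : I × I → ℝ) : ℝ := 6 * (∫ v : I, ∫ t : I, partialOne C t v ^ 2) - 2

/-- `C` is the copula of a random vector `(U₁, U₂)` with joint law `μ` on the unit square:
`P(U₁ ≤ u, U₂ ≤ v) = C(u, v)`. -/
def HasLaw (C : I × I → ℝ) (μ : Measure (I × I)) : Prop :=
  ∀ u v : I, μ.real (Iic u ×ˢ Iic v) = C (u, v)

/-- A copula `C` is stochastically increasing (SI) if for `(U₁, U₂) ∼ C` and every `v`, the
conditional probability `P(U₂ ≥ v ∣ U₁ = u)` is increasing in `u` outside a Lebesgue null set.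
(The law of `(U₁, U₂)` is determined by `C`.) -/
def IsSI (C : I × I → ℝ) : Prop :=
  IsCopula C ∧ ∃ (μ : Measure (I × I)) (_ : IsProbabilityMeasure μ), HasLaw C μ ∧
    ∀ v : I, ∃ N : Set I, volume N = 0 ∧
      MonotoneOn (fun u : I => (μ.condKernel u).real (Ici v)) Nᶜ

/-- `C` solves `max {ρ(D) : D copula, ξ(D) = c}`. -/
def IsMaximizer (c : ℝ) (C : I × I → ℝ) : Prop :=
  IsCopula C ∧ chatterjeeXi C = c ∧
    ∀ D, IsCopula D → chatterjeeXi D = c → spearmanRho D ≤ spearmanRho C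

/-- `C` is the unique solution of `max {ρ(D) : D copula, ξ(D) = c}`. -/
def IsUniqueMaximizer (c : ℝ) (C : I × I → ℝ) : Prop :=
  IsMaximizer c C ∧ ∀ D, IsMaximizer c D → D = C

/-- The independence copula `Π(u, v) = u v`. -/
def copPi (p : I × I) : ℝ := (p.1 : ℝ) * p.2

/-- The upper Fréchet copula `M(u, v) = min {u, v}`. -/
def copM (p : I × I) : ℝ := min (p.1 : ℝ) p.2

/-- The upper end `s_v` of the linear part of the clamped function `t ↦ b (s_v - t)`. -/
def sPar (b v : ℝ) : ℝ :=
  if (1 ≤ b ∧ v ≤ 1 / (2 * b)) ∨ (b ≤ 1 ∧ v ≤ b / 2) then √(2 * v / b)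
  else if 1 / (2 * b) < v ∧ v ≤ 1 - 1 / (2 * b) then v + 1 / (2 * b)
  else if b / 2 < v ∧ v ≤ 1 - b / 2 then v / b + 1 / 2
  else 1 + 1 / b - √(2 * (1 - v) / b)

/-- The lower end of the linear part within `[0,1]`, namely `max {s_v - 1/b, 0}`. -/
def aPar (b v : ℝ) : ℝ := max (sPar b v - 1 / b) 0

/-- The function `C_b` on the unit square (for `b > 0`). -/
def copC (b : ℝ) (p : I × I) : ℝ :=
  let u : ℝ := p.1
  let v : ℝ := p.2
  let s := sPar b v
  let a := aPar b v
  if u ≤ a then u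
  else if u ≤ s then a + b * (s * (u - a) + (a ^ 2 - u ^ 2) / 2)
  else v

/-- The clipped ramp `clamp(y, α, β) = min {max {y, α}, β}`. -/
def clamp (y α β : ℝ) : ℝ := min (max y α) β

/-- The parameter `b_x`, for `0 < x < 1`. -/
def bPar (x : ℝ) : ℝ :=
  if x ≤ 3 / 10 then
    √(6 * x) / (2 * Real.cos (1 / 3 * Real.arccos (-(3 * √(6 * x) / 5))))
  else (5 + √(5 * (6 * x - 1))) / (10 * (1 - x))

/-- The value `M_x`, for `0 ≤ x ≤ 1`. -/
def maxRho (x : ℝ) : ℝ :=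
  if x = 0 then 0
  else if x ≤ 3 / 10 then bPar x - 3 * bPar x ^ 2 / 10
  else if x < 1 then 1 - 1 / (2 * bPar x ^ 2) + 1 / (5 * bPar x ^ 3)
  else 1

end XiRho

end

noncomputable section

namespace XiRho

/-! ### Integrals over the unit interval -/

/-! For a copula `D` put `d = ∂₁D`. Then `0 ≤ d ≤ 1` and `∫₀¹ d(t,v) dt = v`; after integration by
parts `ρ(D)` is affine in `d` with weight `1 - t`, while `ξ(D)` is affine in `∫ d²`. The problem is
thus to maximize a linear functional at fixed `L²` norm, under a box constraint and one linear
constraint for each `v`. The Lagrangian is maximized pointwise by the projection `h` of `b (s_v -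
t)` onto `[0,1]`, with `s_v` coming from the multiplier of the marginal constraint.

No multiplier theory is needed. The variational inequality of the projection
(`sub_clamp_mul_nonpos`), once integrated, loses the `s_v` terms to the marginals and the squares to
`ξ(D) = ξ(C)`. What is left is `b (ρ(D) - ρ(C)) ≤ -6 ∫ (d - h)²` (`mul_spearmanRho_sub_le`), which
gives optimality and uniqueness together.

The rest is explicit. `sPar` inverts the mass of the ramp (`sPar_spec`), so `C_b` is a copula with
derivative `h`. The substitution `v = rampMass b s` (`integral_comp_sPar`) makes `ξ(C_b)` and
`ρ(C_b)` piecewise polynomial integrals, and solving `ξ(C_b) = c` gives `bPar`. The endpoints are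
separate: `ξ(D) = 0` forces `∂₁D = v` almost everywhere, and `M` is the pointwise largest copula. -/

lemma integral_coe_unitInterval (f : ℝ → ℝ) : ∫ t : I, f t = ∫ t in (0 : ℝ)..1, f t := by
  rw [intervalIntegral.integral_of_le zero_le_one, ← integral_Icc_eq_integral_Ioc]
  exact unitInterval.measurePreserving_coe.integral_comp unitInterval.measurableEmbedding_coe f

lemma setIntegral_Iic_unitInterval (u : I) (f : ℝ → ℝ) :
    ∫ t in Iic u, f (t : I) = ∫ t in (0 : ℝ)..u, f t := by
  have h := unitInterval.measurePreserving_coe.setIntegral_image_emb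
    unitInterval.measurableEmbedding_coe f (Iic u)
  rw [image_subtype_val_Icc_Iic, Measure.restrict_restrict measurableSet_Icc,
    inter_eq_left.2 (Icc_subset_Icc_right u.2.2)] at h
  rw [← h, intervalIntegral.integral_of_le u.2.1, integral_Icc_eq_integral_Ioc]

lemma integrable_of_bounded {α : Type*} [MeasurableSpace α] {μ : Measure α} [IsFiniteMeasure μ]
    {f : α → ℝ} (hf : AEStronglyMeasurable f μ) (K : ℝ) (hK : ∀ x, |f x| ≤ K) :
    Integrable f μ :=
  Integrable.of_bound hf K (ae_of_all _ hK)

lemma abs_coe_le_one (t : I) : |(t : ℝ)| ≤ 1 := abs_le.2 ⟨by linarith [t.2.1], t.2.2⟩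

/-- Lets almost everywhere equality of continuous functions on the square be upgraded to equality,
as uniqueness requires. -/
instance isOpenPosMeasure_unitInterval : (volume : Measure I).IsOpenPosMeasure where
  open_pos U hU hne := by
    obtain ⟨V, hV, rfl⟩ := isOpen_induced_iff.1 hU
    obtain ⟨x, hx⟩ := hne
    have hcl : (x : ℝ) ∈ closure (Ioo (0 : ℝ) 1) := by
      rw [closure_Ioo zero_ne_one]; exact x.2
    have hpos := (hV.inter isOpen_Ioo).measure_pos volume (mem_closure_iff.1 hcl V hV hx)
    rw [unitInterval.volume_apply, Subtype.image_preimage_coe]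
    exact (hpos.trans_le (measure_mono (t := Icc 0 1 ∩ V) fun y hy => ⟨Ioo_subset_Icc_self hy.2, hy.1⟩)).ne'

/-! ### Regularity of copulas -/

namespace IsCopula

variable {C D : I × I → ℝ}

lemma mono_left (h : IsCopula C) (v : I) : Monotone fun u => C (u, v) := fun u u' huu' => by
  have := h.two_increasing u u' 0 v huu' v.2.1
  simp only [h.grounded_right] at this
  show C (u, v) ≤ C (u', v)
  linarith

lemma mono_right (h : IsCopula C) (u : I) : Monotone fun v => C (u, v) := fun v v' hvv' => by
  have := h.two_increasing 0 u v v' u.2.1 hvv'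
  simp only [h.grounded_left] at this
  show C (u, v) ≤ C (u, v')
  linarith

lemma sub_le_left (h : IsCopula C) {u u' : I} (v : I) (huu' : u ≤ u') :
    C (u', v) - C (u, v) ≤ u' - u := by
  have := h.two_increasing u u' v 1 huu' v.2.2
  simp only [h.marginal_left] at this
  linarith

lemma sub_le_right (h : IsCopula C) (u : I) {v v' : I} (hvv' : v ≤ v') :
    C (u, v') - C (u, v) ≤ v' - v := by
  have := h.two_increasing u 1 v v' u.2.2 hvv'
  simp only [h.marginal_right] at this
  linarith

lemma lipschitzWith_left (h : IsCopula C) (v : I) : LipschitzWith 1 fun u => C (u, v) := by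
  refine LipschitzWith.of_le_add fun u u' => ?_
  rw [Subtype.dist_eq, Real.dist_eq]
  rcases le_total u u' with huu' | huu'
  · have := h.mono_left v huu'
    have := abs_nonneg ((u : ℝ) - u')
    simp only at *
    linarith
  · have := h.sub_le_left v huu'
    have := le_abs_self ((u : ℝ) - u')
    linarith

lemma lipschitzWith_right (h : IsCopula C) (u : I) : LipschitzWith 1 fun v => C (u, v) := by
  refine LipschitzWith.of_le_add fun v v' => ?_
  rw [Subtype.dist_eq, Real.dist_eq]
  rcases le_total v v' with hvv' | hvv'
  · have := h.mono_right u hvv'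
    have := abs_nonneg ((v : ℝ) - v')
    simp only at *
    linarith
  · have := h.sub_le_right u hvv'
    have := le_abs_self ((v : ℝ) - v')
    linarith

lemma continuous (h : IsCopula C) : Continuous C :=
  (LipschitzWith.uncurry (f := fun u v => C (u, v)) h.lipschitzWith_left
    h.lipschitzWith_right).continuous

lemma le_min (h : IsCopula C) (p : I × I) : C p ≤ copM p := by
  refine _root_.le_min ?_ ?_
  · rw [← h.marginal_left p.1]
    exact h.mono_right p.1 p.2.2.2
  · rw [← h.marginal_right p.2]
    exact h.mono_left p.2 p.1.2.2

/-! ### The first partial derivative: bounds and measurability -/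

lemma firstSection_coe (C : I × I → ℝ) (u v : I) : firstSection C v u = C (u, v) := by
  simp [firstSection]

lemma monotone_firstSection (h : IsCopula C) (v : I) : Monotone (firstSection C v) :=
  (h.mono_left v).IccExtend _

lemma lipschitzWith_firstSection (h : IsCopula C) (v : I) : LipschitzWith 1 (firstSection C v) := by
  simpa [firstSection, IccExtend] using
    (h.lipschitzWith_left v).comp (LipschitzWith.projIcc (zero_le_one (α := ℝ)))

lemma absolutelyContinuous_firstSection (h : IsCopula C) (v : I) (a b : ℝ) :
    AbsolutelyContinuousOnInterval (firstSection C v) a b :=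
  ((h.lipschitzWith_firstSection v).lipschitzOnWith).absolutelyContinuousOnInterval

lemma partialOne_nonneg (h : IsCopula C) (t v : I) : 0 ≤ partialOne C t v :=
  ((h.monotone_firstSection v).monotoneOn _).derivWithin_nonneg

lemma partialOne_le_one (h : IsCopula C) (t v : I) : partialOne C t v ≤ 1 := by
  have hm : MonotoneOn (fun x => x - firstSection C v x) (Icc 0 1) := by
    intro x hx y hy hxy
    have := (h.lipschitzWith_firstSection v).dist_le_mul y x
    rw [Real.dist_eq, Real.dist_eq, abs_of_nonneg (sub_nonneg.2 hxy)] at this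
    have h2 := le_abs_self (firstSection C v y - firstSection C v x)
    simp only [NNReal.coe_one, one_mul] at *
    linarith
  by_cases hd : DifferentiableWithinAt ℝ (firstSection C v) (Icc 0 1) t
  · have := hm.derivWithin_nonneg (x := (t : ℝ))
    rw [derivWithin_fun_sub differentiableWithinAt_fun_id hd, derivWithin_id'] at this
    · unfold partialOne; linarith
    · exact uniqueDiffOn_Icc zero_lt_one _ t.2
  -- The default value `0` of `derivWithin` keeps the bound valid at every `t`, not just almost
  -- every `t`.
  · rw [partialOne, derivWithin_zero_of_not_differentiableWithinAt hd]
    exact zero_le_one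

lemma abs_partialOne_le_one (h : IsCopula C) (t v : I) : |partialOne C t v| ≤ 1 :=
  abs_le.2 ⟨by linarith [h.partialOne_nonneg t v], h.partialOne_le_one t v⟩

lemma partialOne_eq_deriv (C : I × I → ℝ) {t : I} (h0 : t ≠ 0) (h1 : t ≠ 1) (v : I) :
    partialOne C t v = deriv (firstSection C v) t :=
  derivWithin_of_mem_nhds <| Icc_mem_nhds (unitInterval.pos_iff_ne_zero.2 h0)
    (unitInterval.lt_one_iff_ne_one.2 h1)

/-- Only the endpoints differ, so measurability and the fundamental theorem of calculus can be
applied to the two-sided `deriv`. -/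
lemma partialOne_ae_eq_deriv (C : I × I → ℝ) (v : I) :
    ∀ᵐ t : I, partialOne C t v = deriv (firstSection C v) t := by
  filter_upwards [compl_mem_ae_iff.2 (measure_singleton (0 : I)),
    compl_mem_ae_iff.2 (measure_singleton (1 : I))] with t h0 h1
  exact partialOne_eq_deriv C h0 h1 v

lemma continuous_uncurry_firstSection (h : IsCopula C) :
    Continuous (Function.uncurry fun v : I => firstSection C v) := by
  have : (Function.uncurry fun v : I => firstSection C v) =
      C ∘ fun q : I × ℝ => (projIcc 0 1 zero_le_one q.2, q.1) := rfl
  rw [this]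
  exact h.continuous.comp ((continuous_projIcc.comp continuous_snd).prodMk continuous_fst)

lemma aestronglyMeasurable_partialOne (h : IsCopula C) :
    AEStronglyMeasurable (fun p : I × I => partialOne C p.1 p.2) := by
  have hm : Measurable fun p : I × I => deriv (firstSection C p.2) p.1 :=
    (measurable_deriv_with_param h.continuous_uncurry_firstSection).comp
      (measurable_snd.prodMk (measurable_subtype_coe.comp measurable_fst))
  refine hm.aestronglyMeasurable.congr ?_
  have hq : ∀ x : I, ∀ᵐ p : I × I, p.1 ≠ x := fun x =>
    (Measure.quasiMeasurePreserving_fst (μ := (volume : Measure I))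
      (ν := (volume : Measure I))).ae (compl_mem_ae_iff.2 (measure_singleton x))
  filter_upwards [hq 0, hq 1] with p h0 h1
  exact (partialOne_eq_deriv C h0 h1 p.2).symm

lemma integrable_partialOne_sq (h : IsCopula C) :
    Integrable fun p : I × I => partialOne C p.1 p.2 ^ 2 :=
  integrable_of_bounded (h.aestronglyMeasurable_partialOne.pow 2) 1 fun p => by
    rw [abs_pow]; exact pow_le_one₀ (abs_nonneg _) (h.abs_partialOne_le_one _ _)

lemma integrable_mul_partialOne (h : IsCopula C) {g : I × I → ℝ} (hg : AEStronglyMeasurable g)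
    (K : ℝ) (hK : ∀ p, |g p| ≤ K) :
    Integrable fun p : I × I => g p * partialOne C p.1 p.2 :=
  integrable_of_bounded (hg.mul h.aestronglyMeasurable_partialOne) K fun p => by
    rw [abs_mul]
    exact (mul_le_of_le_one_right (abs_nonneg _) (h.abs_partialOne_le_one _ _)).trans (hK p)

/-! ### `ρ`, `ξ` and the marginals as integrals of `∂₁C` -/

lemma setIntegral_partialOne (h : IsCopula C) (u v : I) :
    ∫ t in Iic u, partialOne C t v = C (u, v) := by
  rw [setIntegral_congr_ae (g := fun t : I => deriv (firstSection C v) t) measurableSet_Iic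
    ((partialOne_ae_eq_deriv C v).mono fun t ht _ => ht),
    setIntegral_Iic_unitInterval u (deriv (firstSection C v)),
    (h.absolutelyContinuous_firstSection v 0 u).integral_deriv_eq_sub, firstSection_coe]
  have := firstSection_coe C 0 v
  rw [h.grounded_left] at this
  simp only [Icc.coe_zero] at this
  rw [this, sub_zero]

lemma integral_partialOne (h : IsCopula C) (v : I) : ∫ t : I, partialOne C t v = v := by
  have := h.setIntegral_partialOne 1 v
  rwa [h.marginal_right, show Iic (1 : I) = univ from eq_univ_of_forall fun x => x.2.2,
    setIntegral_univ] at this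

/-- Integration by parts: the boundary terms vanish because `1 - t` is zero at `1` and `C(0, v) =
0`. -/
lemma integral_section (h : IsCopula C) (v : I) :
    ∫ u : I, C (u, v) = ∫ t : I, (1 - (t : ℝ)) * partialOne C t v := by
  have h1 : ∫ u : I, C (u, v) = ∫ u : I, firstSection C v u := by
    simp_rw [firstSection_coe]
  have h2 : ∫ t : I, (1 - (t : ℝ)) * partialOne C t v =
      ∫ t : I, (1 - (t : ℝ)) * deriv (firstSection C v) t :=
    integral_congr_ae ((partialOne_ae_eq_deriv C v).mono fun t ht => by simp only [ht])
  rw [h1, h2, integral_coe_unitInterval,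
    integral_coe_unitInterval fun t => (1 - t) * deriv (firstSection C v) t]
  have hlin : AbsolutelyContinuousOnInterval (fun t : ℝ => 1 - t) 0 1 :=
    ContDiffOn.absolutelyContinuousOnInterval (by fun_prop)
  have hf0 := firstSection_coe C 0 v
  rw [h.grounded_left, Icc.coe_zero] at hf0
  rw [hlin.integral_mul_deriv_eq_deriv_mul (h.absolutelyContinuous_firstSection v 0 1), hf0]
  simp

lemma integral_eq (h : IsCopula C) :
    ∫ p : I × I, C p = ∫ p : I × I, (1 - (p.1 : ℝ)) * partialOne C p.1 p.2 := by
  have hC : Integrable C ((volume : Measure I).prod volume) :=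
    integrable_of_bounded h.continuous.aestronglyMeasurable 1 fun p =>
      abs_le.2 ⟨by linarith [(h.mem_Icc p).1], (h.mem_Icc p).2⟩
  have hg : Integrable (fun p : I × I => (1 - (p.1 : ℝ)) * partialOne C p.1 p.2)
      ((volume : Measure I).prod volume) :=
    h.integrable_mul_partialOne (by fun_prop) 1 fun p =>
      abs_le.2 ⟨by linarith [p.1.2.2], by linarith [p.1.2.1]⟩
  rw [Measure.volume_eq_prod, integral_prod_symm _ hC, integral_prod_symm _ hg]
  exact integral_congr_ae (ae_of_all _ fun v => h.integral_section v)

lemma spearmanRho_eq (h : IsCopula C) :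
    spearmanRho C = 12 * (∫ p : I × I, (1 - (p.1 : ℝ)) * partialOne C p.1 p.2) - 3 := by
  rw [spearmanRho, h.integral_eq]

lemma chatterjeeXi_eq (h : IsCopula C) :
    chatterjeeXi C = 6 * (∫ p : I × I, partialOne C p.1 p.2 ^ 2) - 2 := by
  have := h.integrable_partialOne_sq
  rw [Measure.volume_eq_prod] at this ⊢
  rw [chatterjeeXi, integral_prod_symm _ this]

/-- The right side does not depend on `C`: terms weighted by a function of `v` alone cancel when two
copulas are compared. -/
lemma integral_mul_snd (h : IsCopula C) {g : I → ℝ} (hg : Measurable g) (K : ℝ)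
    (hK : ∀ v, |g v| ≤ K) :
    ∫ p : I × I, g p.2 * partialOne C p.1 p.2 = ∫ v : I, g v * v := by
  have := h.integrable_mul_partialOne (g := fun p => g p.2)
    (hg.comp measurable_snd).aestronglyMeasurable K fun p => hK p.2
  rw [Measure.volume_eq_prod] at this ⊢
  rw [integral_prod_symm _ this]
  simp only [integral_const_mul, h.integral_partialOne]

/-- Copulas with almost everywhere equal partial derivatives are equal. -/
lemma eq_of_partialOne_ae_eq (hC : IsCopula C) (hD : IsCopula D)
    (h : ∀ᵐ p : I × I, partialOne D p.1 p.2 = partialOne C p.1 p.2) : D = C := by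
  have h1 : ∀ᵐ v : I, ∀ᵐ t : I, partialOne D t v = partialOne C t v := by
    have h2 : ∀ᵐ q : I × I, partialOne D q.2 q.1 = partialOne C q.2 q.1 :=
      (Measure.measurePreserving_swap (μ := (volume : Measure I))
        (ν := (volume : Measure I))).quasiMeasurePreserving.ae h
    rw [Measure.volume_eq_prod] at h2
    exact Measure.ae_ae_of_ae_prod h2
  funext ⟨u, v⟩
  -- Integrating the derivative gives equality for almost every `v` only; continuity in `v` covers
  -- the rest.
  have h3 : (fun v => D (u, v)) = fun v => C (u, v) := by
    refine ((hD.lipschitzWith_right u).continuous.ae_eq_iff_eq volume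
      (hC.lipschitzWith_right u).continuous).1 ?_
    filter_upwards [h1] with v hv
    rw [← hD.setIntegral_partialOne, ← hC.setIntegral_partialOne]
    exact setIntegral_congr_ae measurableSet_Iic (hv.mono fun t ht _ => ht)
  exact congrFun h3 v

lemma integrable_sub_sq (hC : IsCopula C) (hD : IsCopula D) :
    Integrable fun p : I × I => (partialOne D p.1 p.2 - partialOne C p.1 p.2) ^ 2 :=
  integrable_of_bounded ((hD.aestronglyMeasurable_partialOne.sub
    hC.aestronglyMeasurable_partialOne).pow 2) 1 fun p => by
      rw [abs_pow]
      refine pow_le_one₀ (abs_nonneg _) (abs_le.2 ?_)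
      have := hD.partialOne_nonneg p.1 p.2
      have := hD.partialOne_le_one p.1 p.2
      have := hC.partialOne_nonneg p.1 p.2
      have := hC.partialOne_le_one p.1 p.2
      constructor <;> linarith

lemma eq_of_integral_sq_nonpos (hC : IsCopula C) (hD : IsCopula D)
    (h : ∫ p : I × I, (partialOne D p.1 p.2 - partialOne C p.1 p.2) ^ 2 ≤ 0) : D = C := by
  refine hC.eq_of_partialOne_ae_eq hD ?_
  have h0 := (integral_eq_zero_iff_of_nonneg (fun p => sq_nonneg _)
    (hC.integrable_sub_sq hD)).1
    (le_antisymm h (integral_nonneg fun p => sq_nonneg _))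
  filter_upwards [h0] with p hp
  exact sub_eq_zero.1 (pow_eq_zero_iff two_ne_zero |>.1 hp)

end IsCopula

/-! ### Optimality of copulas with clamped linear partial derivative -/

lemma clamp_mem_Icc (y : ℝ) : clamp y 0 1 ∈ Icc (0 : ℝ) 1 :=
  ⟨le_min (le_max_right _ _) zero_le_one, min_le_right _ _⟩

/-- The variational inequality for the projection onto `[0,1]`. -/
lemma sub_clamp_mul_nonpos (y : ℝ) {d : ℝ} (hd : d ∈ Icc (0 : ℝ) 1) :
    (d - clamp y 0 1) * (y - clamp y 0 1) ≤ 0 := by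
  unfold clamp
  rcases le_total y 0 with h0 | h0
  · rw [max_eq_right h0, min_eq_left zero_le_one]
    nlinarith [hd.1]
  · rw [max_eq_left h0]
    rcases le_total y 1 with h1 | h1
    · rw [min_eq_left h1]; simp
    · rw [min_eq_right h1]
      nlinarith [hd.2]

namespace IsCopula

variable {C D : I × I → ℝ}

lemma mul_spearmanRho_sub_le (hC : IsCopula C) (hD : IsCopula D) (b : ℝ) {s : I → ℝ}
    (hs : Measurable s) (K : ℝ) (hK : ∀ v, |s v| ≤ K)
    (hpart : ∀ t v : I, partialOne C t v = clamp (b * (s v - t)) 0 1)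
    (hxi : chatterjeeXi D = chatterjeeXi C) :
    b * (spearmanRho D - spearmanRho C) ≤
      -6 * ∫ p : I × I, (partialOne D p.1 p.2 - partialOne C p.1 p.2) ^ 2 := by
  have hgK : ∀ v, |b * (s v - 1)| ≤ |b| * (K + 1) := fun v => by
    rw [abs_mul]
    gcongr
    exact (abs_sub _ _).trans (by rw [abs_one]; linarith [hK v])
  have hgm : Measurable fun v => b * (s v - 1) := by fun_prop
  have i1 := fun {E : I × I → ℝ} (hE : IsCopula E) =>
    hE.integrable_mul_partialOne (g := fun p => 1 - (p.1 : ℝ)) (by fun_prop) 1 fun p =>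
      abs_le.2 ⟨by linarith [p.1.2.2], by linarith [p.1.2.1]⟩
  have i2 := fun {E : I × I → ℝ} (hE : IsCopula E) =>
    hE.integrable_mul_partialOne (g := fun p => b * (s p.2 - 1))
      (hgm.comp measurable_snd).aestronglyMeasurable _ fun p => hgK p.2
  -- With `y = b (1 - t) + b (s_v - 1)`, this is `(d - h)(y - h) ≤ 0` after writing `(d - h) h = (d²
  -- - h²)/2 - (d - h)²/2`.
  have key : ∫ p : I × I, (b * ((1 - (p.1 : ℝ)) * partialOne D p.1 p.2
      - (1 - (p.1 : ℝ)) * partialOne C p.1 p.2)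
      + (b * (s p.2 - 1) * partialOne D p.1 p.2 - b * (s p.2 - 1) * partialOne C p.1 p.2)
      - 1 / 2 * (partialOne D p.1 p.2 ^ 2 - partialOne C p.1 p.2 ^ 2)
      + 1 / 2 * (partialOne D p.1 p.2 - partialOne C p.1 p.2) ^ 2) ≤ 0 := by
    refine integral_nonpos fun p => ?_
    have := sub_clamp_mul_nonpos (b * (s p.2 - p.1))
      ⟨hD.partialOne_nonneg p.1 p.2, hD.partialOne_le_one p.1 p.2⟩
    rw [← hpart] at this
    simp only [Pi.zero_apply]
    linarith
  have i3 := hC.integrable_partialOne_sq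
  have i4 := hD.integrable_partialOne_sq
  have i5 := hC.integrable_sub_sq hD
  have j1 := ((i1 hD).sub' (i1 hC)).const_mul b
  have j2 := (i2 hD).sub' (i2 hC)
  have j3 := (i4.sub' i3).const_mul (1 / 2)
  rw [integral_add ((j1.fun_add j2).sub' j3) (i5.const_mul _),
    integral_sub (j1.fun_add j2) j3, integral_add j1 j2,
    integral_const_mul, integral_const_mul, integral_const_mul,
    integral_sub (i1 hD) (i1 hC), integral_sub (i2 hD) (i2 hC), integral_sub i4 i3,
    hD.integral_mul_snd hgm _ hgK, hC.integral_mul_snd hgm _ hgK] at key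
  rw [hD.chatterjeeXi_eq, hC.chatterjeeXi_eq] at hxi
  rw [hD.spearmanRho_eq, hC.spearmanRho_eq]
  linarith

lemma isUniqueMaximizer_of_clamp (hC : IsCopula C) {b : ℝ} (hb : 0 < b) {s : I → ℝ}
    (hs : Measurable s) (K : ℝ) (hK : ∀ v, |s v| ≤ K)
    (hpart : ∀ t v : I, partialOne C t v = clamp (b * (s v - t)) 0 1) :
    IsUniqueMaximizer (chatterjeeXi C) C := by
  have hle : ∀ D, IsCopula D → chatterjeeXi D = chatterjeeXi C →
      spearmanRho D ≤ spearmanRho C := fun D hD hxi => by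
    have h1 := hC.mul_spearmanRho_sub_le hD b hs K hK hpart hxi
    have h2 : 0 ≤ ∫ p : I × I, (partialOne D p.1 p.2 - partialOne C p.1 p.2) ^ 2 :=
      integral_nonneg fun p => sq_nonneg _
    by_contra! hlt
    have := mul_pos hb (sub_pos.2 hlt)
    linarith
  refine ⟨⟨hC, rfl, hle⟩, fun D ⟨hD, hxi, hmax⟩ => ?_⟩
  have h1 := hC.mul_spearmanRho_sub_le hD b hs K hK hpart hxi
  rw [le_antisymm (hle D hD hxi) (hmax C hC rfl), sub_self, mul_zero] at h1
  exact hC.eq_of_integral_sq_nonpos hD (by linarith)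

end IsCopula

/-! ### Powers of the positive part -/

/-- From exponent `2` on, the kink at `0` is smoothed to a `C¹` function. Writing ramps in positive
parts thus lets one antiderivative serve all cases of `C_b`. -/
lemma hasDerivAt_posPart_pow (n : ℕ) (x : ℝ) :
    HasDerivAt (fun y : ℝ => max y 0 ^ (n + 2)) ((n + 2) * max x 0 ^ (n + 1)) x := by
  have hp : ∀ y : ℝ, HasDerivAt (fun z : ℝ => z ^ (n + 2)) ((n + 2) * y ^ (n + 1)) y :=
    fun y => by simpa using hasDerivAt_pow (n + 2) y
  rcases lt_trichotomy x 0 with h | rfl | h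
  · rw [max_eq_right h.le, zero_pow (by omega), mul_zero]
    refine (hasDerivAt_const x (0 : ℝ)).congr_of_eventuallyEq ?_
    filter_upwards [gt_mem_nhds h] with y hy
    simp [max_eq_right (le_of_lt hy)]
  · have h1 : HasDerivWithinAt (fun y : ℝ => max y 0 ^ (n + 2))
        ((n + 2) * max (0 : ℝ) 0 ^ (n + 1)) (Iic 0) 0 := by
      rw [max_self, zero_pow (by omega), mul_zero]
      refine (hasDerivWithinAt_const (0 : ℝ) (Iic 0) (0 : ℝ)).congr (fun y hy => ?_) (by simp)
      simp [max_eq_right (show y ≤ 0 from hy)]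
    have h2 : HasDerivWithinAt (fun y : ℝ => max y 0 ^ (n + 2))
        ((n + 2) * max (0 : ℝ) 0 ^ (n + 1)) (Ici 0) 0 := by
      rw [max_self]
      refine (hp 0).hasDerivWithinAt.congr (fun y hy => ?_) (by simp)
      simp [max_eq_left (show 0 ≤ y from hy)]
    have := h1.union h2
    rwa [Iic_union_Ici, hasDerivWithinAt_univ] at this
  · rw [max_eq_left h.le]
    refine (hp x).congr_of_eventuallyEq ?_
    filter_upwards [lt_mem_nhds h] with y hy
    simp [max_eq_left (le_of_lt hy)]

lemma hasDerivAt_posPart_sub_pow (n : ℕ) (r x : ℝ) :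
    HasDerivAt (fun y : ℝ => max (y - r) 0 ^ (n + 2)) ((n + 2) * max (x - r) 0 ^ (n + 1)) x := by
  simpa using! (hasDerivAt_posPart_pow n (x - r)).comp x ((hasDerivAt_id x).sub_const r)

lemma hasDerivAt_posPart_const_sub_pow (n : ℕ) (r x : ℝ) :
    HasDerivAt (fun y : ℝ => max (r - y) 0 ^ (n + 2)) (-((n + 2) * max (r - x) 0 ^ (n + 1))) x := by
  simpa using! (hasDerivAt_posPart_pow n (r - x)).comp x ((hasDerivAt_id x).const_sub r)

/-! ### The mass of a clamped ramp -/

/-- The mass `∫₀¹ min (max (b (s - t)) 0) 1 dt` of the clamped ramp, for `0 ≤ s ≤ 1 + 1 / b`. -/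
def rampMass (b s : ℝ) : ℝ := b / 2 * (s ^ 2 - max (s - 1) 0 ^ 2 - max (s - 1 / b) 0 ^ 2)

/-- The derivative of `rampMass b`. -/
def rampMassDeriv (b s : ℝ) : ℝ := b * (s - max (s - 1) 0 - max (s - 1 / b) 0)

lemma hasDerivAt_rampMass (b s : ℝ) : HasDerivAt (rampMass b) (rampMassDeriv b s) s := by
  have h := (((hasDerivAt_pow 2 s).sub (hasDerivAt_posPart_sub_pow 0 1 s)).sub
    (hasDerivAt_posPart_sub_pow 0 (1 / b) s)).const_mul (b / 2)
  refine h.congr_deriv ?_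
  simp [rampMassDeriv]
  ring

variable {b : ℝ}

lemma rampMassDeriv_pos (hb : 0 < b) {s : ℝ} (hs : s ∈ Ioo 0 (1 + 1 / b)) :
    0 < rampMassDeriv b s := by
  have hr : 0 < 1 / b := by positivity
  refine mul_pos hb ?_
  obtain ⟨h0, h1⟩ := hs
  rcases max_cases (s - 1) 0 with h | h <;> rcases max_cases (s - 1 / b) 0 with h' | h' <;> linarith

lemma strictMonoOn_rampMass (hb : 0 < b) : StrictMonoOn (rampMass b) (Icc 0 (1 + 1 / b)) := by
  refine strictMonoOn_of_deriv_pos (convex_Icc _ _)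
    (fun s _ => (hasDerivAt_rampMass b s).continuousAt.continuousWithinAt) fun s hs => ?_
  rw [interior_Icc] at hs
  rw [(hasDerivAt_rampMass b s).deriv]
  exact rampMassDeriv_pos hb hs

lemma continuous_rampMass (b : ℝ) : Continuous (rampMass b) :=
  continuous_iff_continuousAt.2 fun s => (hasDerivAt_rampMass b s).continuousAt

lemma rampMass_zero (hb : 0 < b) : rampMass b 0 = 0 := by
  have : -b⁻¹ ≤ 0 := by simpa using hb.le
  simp [rampMass, max_eq_right this]

lemma rampMass_one_add (hb : 0 < b) : rampMass b (1 + 1 / b) = 1 := by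
  have hr : 0 < 1 / b := by positivity
  rw [rampMass, show 1 + 1 / b - 1 = 1 / b by ring, show 1 + 1 / b - 1 / b = 1 by ring,
    max_eq_left hr.le, max_eq_left zero_le_one]
  field_simp
  ring

/-- The four branches solve the quadratic or linear equation `rampMass b s = v`, according to the
signs of `s - 1` and `s - 1/b`. -/
lemma sPar_spec (hb : 0 < b) {v : ℝ} (hv : v ∈ Icc (0 : ℝ) 1) :
    sPar b v ∈ Icc 0 (1 + 1 / b) ∧ rampMass b (sPar b v) = v := by
  obtain ⟨hv0, hv1⟩ := hv
  have hr : 0 < 1 / b := by positivity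
  have hbr : b * (1 / b) = 1 := by field_simp
  have e1 : 1 / (2 * b) = 1 / b / 2 := by field_simp
  have e2 : ∀ x, x / b = x * (1 / b) := fun x => by ring
  unfold sPar rampMass
  rw [e1]
  simp only [e2 (2 * _), e2 v]
  generalize 1 / b = r at *
  -- Stated for general `x`: used with `v` in the first branch and, by the symmetry `v ↦ 1 - v`,
  -- with `1 - v` in the last.
  have hlow : ∀ x, 0 ≤ x → ((1 ≤ b ∧ x ≤ r / 2) ∨ (b ≤ 1 ∧ x ≤ b / 2)) →
      √(2 * x * r) ≤ 1 ∧ √(2 * x * r) ≤ r := by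
    rintro x hx0 (⟨h1, h2⟩ | ⟨h1, h2⟩)
    · have : r ≤ 1 := by nlinarith
      constructor
      · rw [Real.sqrt_le_left zero_le_one]; nlinarith
      · rw [Real.sqrt_le_left hr.le]; nlinarith
    · have : 1 ≤ r := by nlinarith
      constructor
      · rw [Real.sqrt_le_left zero_le_one]; nlinarith
      · rw [Real.sqrt_le_left hr.le]; nlinarith
  have hsq : ∀ x, 0 ≤ x → √(2 * x * r) ^ 2 = 2 * x * r := fun x hx => Real.sq_sqrt (by positivity)
  have hbs : ∀ x, b / 2 * (2 * x * r) = x := fun x => by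
    rw [show b / 2 * (2 * x * r) = x * (b * r) by ring, hbr, mul_one]
  split_ifs with h1 h2 h3
  · obtain ⟨hs1, hsr⟩ := hlow v hv0 h1
    have hs0 := Real.sqrt_nonneg (2 * v * r)
    refine ⟨⟨hs0, by linarith⟩, ?_⟩
    rw [max_eq_right (by linarith), max_eq_right (by linarith), hsq v hv0]
    linear_combination hbs v
  · refine ⟨⟨by linarith, by linarith⟩, ?_⟩
    rw [max_eq_right (by linarith), max_eq_left (by linarith)]
    linear_combination v * hbr
  · have h4 : v * r * b = v := by linear_combination v * hbr
    have hb1 : b ≤ 1 := by linarith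
    have hr1 : 1 ≤ r := by nlinarith
    have h5 : 1 / 2 ≤ v * r := by nlinarith
    have h6 : v * r ≤ r - 1 / 2 := by nlinarith
    refine ⟨⟨by linarith, by linarith⟩, ?_⟩
    rw [max_eq_left (by linarith), max_eq_right (by linarith)]
    linear_combination h4
  · have hcase : (1 ≤ b ∧ 1 - v ≤ r / 2) ∨ (b ≤ 1 ∧ 1 - v ≤ b / 2) := by
      rcases le_total 1 b with hb1 | hb1
      · left
        refine ⟨hb1, ?_⟩
        by_contra! hlt
        exact h2 ⟨not_le.1 fun hle => h1 (Or.inl ⟨hb1, hle⟩), by linarith⟩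
      · right
        refine ⟨hb1, ?_⟩
        by_contra! hlt
        exact h3 ⟨not_le.1 fun hle => h1 (Or.inr ⟨hb1, hle⟩), by linarith⟩
    obtain ⟨hs1, hsr⟩ := hlow (1 - v) (by linarith) hcase
    have hs0 := Real.sqrt_nonneg (2 * (1 - v) * r)
    have hs2 := hsq (1 - v) (by linarith)
    set w := √(2 * (1 - v) * r)
    refine ⟨⟨by linarith, by linarith⟩, ?_⟩
    rw [max_eq_left (by linarith), max_eq_left (by linarith)]
    linear_combination (1 - (1 - v)) * hbr - b / 2 * hs2

lemma sPar_mem_Icc (hb : 0 < b) (v : I) : sPar b v ∈ Icc 0 (1 + 1 / b) := (sPar_spec hb v.2).1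

lemma rampMass_sPar (hb : 0 < b) (v : I) : rampMass b (sPar b v) = v := (sPar_spec hb v.2).2

lemma monotone_sPar (hb : 0 < b) : Monotone fun v : I => sPar b v := fun v v' hvv' => by
  refine ((strictMonoOn_rampMass hb).le_iff_le (sPar_mem_Icc hb v) (sPar_mem_Icc hb v')).1 ?_
  rw [rampMass_sPar hb, rampMass_sPar hb]
  exact hvv'

lemma measurable_sPar (hb : 0 < b) : Measurable fun v : I => sPar b v :=
  (monotone_sPar hb).measurable

lemma abs_sPar_le (hb : 0 < b) (v : I) : |sPar b v| ≤ 1 + 1 / b := by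
  obtain ⟨h0, h1⟩ := sPar_mem_Icc hb v
  rwa [abs_of_nonneg h0]

lemma sPar_zero (hb : 0 < b) : sPar b (0 : I) = 0 := by
  refine (strictMonoOn_rampMass hb).injOn (sPar_mem_Icc hb 0) ⟨le_rfl, by positivity⟩ ?_
  rw [rampMass_sPar hb, rampMass_zero hb, Icc.coe_zero]

lemma sPar_one (hb : 0 < b) : sPar b (1 : I) = 1 + 1 / b := by
  refine (strictMonoOn_rampMass hb).injOn (sPar_mem_Icc hb 1) ⟨by positivity, le_rfl⟩ ?_
  rw [rampMass_sPar hb, rampMass_one_add hb, Icc.coe_one]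

/-! ### The copulas `C_b` -/

/-- The integral `∫₀ᵘ min (max (b (s - t)) 0) 1 dt`, for `0 ≤ s`. -/
def rampIntegral (b s u : ℝ) : ℝ :=
  b / 2 * (s ^ 2 - max (s - u) 0 ^ 2 - max (s - 1 / b) 0 ^ 2 + max (s - 1 / b - u) 0 ^ 2)

lemma clamp_mul_eq (hb : 0 < b) (x : ℝ) :
    clamp (b * x) 0 1 = b * (max x 0 - max (x - 1 / b) 0) := by
  have hbr : b * (1 / b) = 1 := by field_simp
  have hr : 0 < 1 / b := by positivity
  unfold clamp
  generalize 1 / b = r at *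
  rcases le_total x 0 with h0 | h0
  · rw [max_eq_right (by nlinarith), max_eq_right h0, max_eq_right (by linarith),
      min_eq_left zero_le_one]
    ring
  · rw [max_eq_left (by positivity), max_eq_left h0]
    rcases le_total x r with h1 | h1
    · rw [max_eq_right (by linarith), min_eq_left (by nlinarith)]
      ring
    · rw [max_eq_left (by linarith), min_eq_right (by nlinarith)]
      linear_combination -hbr

lemma hasDerivAt_rampIntegral (hb : 0 < b) (s t : ℝ) :
    HasDerivAt (rampIntegral b s) (clamp (b * (s - t)) 0 1) t := by
  have h := ((((hasDerivAt_const t (s ^ 2)).sub (hasDerivAt_posPart_const_sub_pow 0 s t)).sub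
    (hasDerivAt_const t (max (s - 1 / b) 0 ^ 2))).add
    (hasDerivAt_posPart_const_sub_pow 0 (s - 1 / b) t)).const_mul (b / 2)
  refine h.congr_deriv ?_
  rw [clamp_mul_eq hb, show s - t - 1 / b = s - 1 / b - t by ring]
  simp
  ring

lemma copC_eq (hb : 0 < b) (u v : I) : copC b (u, v) = rampIntegral b (sPar b v) u := by
  obtain ⟨⟨hs0, hs1⟩, hmass⟩ := sPar_spec hb v.2
  have hu0 := u.2.1
  have hu1 := u.2.2
  have hbr : b * (1 / b) = 1 := by field_simp
  have hr : 0 < 1 / b := by positivity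
  unfold copC aPar rampIntegral
  unfold rampMass at hmass
  simp only
  generalize sPar b v = s at *
  generalize 1 / b = r at *
  generalize (u : ℝ) = x at *
  generalize (v : ℝ) = y at *
  split_ifs with h1 h2
  · rcases le_total (s - r) 0 with h | h
    · rw [max_eq_right h] at h1
      obtain rfl : x = 0 := le_antisymm h1 hu0
      rw [sub_zero, max_eq_left hs0, sub_zero]
      ring
    · rw [max_eq_left h] at h1 ⊢
      rw [max_eq_left (by linarith), max_eq_left (by linarith)]
      linear_combination -x * hbr
  · rw [not_le] at h1
    have h3 : s - r < x := (le_max_left _ _).trans_lt h1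
    rw [max_eq_left (sub_nonneg.2 h2), max_eq_right (a := s - r - x) (by linarith)]
    rcases le_total (s - r) 0 with h | h
    · rw [max_eq_right h]
      ring
    · rw [max_eq_left h]
      linear_combination -(s - r) * hbr
  · rw [not_le] at h1 h2
    have h3 : s - r < x := (le_max_left _ _).trans_lt h1
    rw [max_eq_right (a := s - x) (by linarith), max_eq_right (a := s - r - x) (by linarith)]
    -- Here `s < x ≤ 1`, so the ramp is exhausted before `x` and the integral up to `x` is the whole
    -- mass `v`.
    rw [max_eq_right (a := s - 1) (by linarith)] at hmass
    linear_combination -hmass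

lemma hasDerivWithinAt_firstSection_copC (hb : 0 < b) (t v : I) :
    HasDerivWithinAt (firstSection (copC b) v) (clamp (b * (sPar b v - t)) 0 1) (Icc 0 1) t := by
  have h : ∀ x ∈ Icc (0 : ℝ) 1, firstSection (copC b) v x = rampIntegral b (sPar b v) x :=
    fun x hx => (IsCopula.firstSection_coe (copC b) ⟨x, hx⟩ v).trans (copC_eq hb ⟨x, hx⟩ v)
  exact (hasDerivAt_rampIntegral hb _ _).hasDerivWithinAt.congr h (h t t.2)

lemma partialOne_copC (hb : 0 < b) (t v : I) :
    partialOne (copC b) t v = clamp (b * (sPar b v - t)) 0 1 :=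
  (hasDerivWithinAt_firstSection_copC hb t v).derivWithin (uniqueDiffOn_Icc zero_lt_one _ t.2)

lemma continuous_clamp : Continuous fun y : ℝ => clamp y 0 1 := by
  unfold clamp; fun_prop

lemma monotone_clamp : Monotone fun y : ℝ => clamp y 0 1 := fun _ _ h =>
  min_le_min_right _ (max_le_max_right _ h)

lemma clamp_sub_clamp_le {x y : ℝ} (h : x ≤ y) : clamp y 0 1 - clamp x 0 1 ≤ y - x := by
  unfold clamp
  rcases max_cases y 0 with h1 | h1 <;> rcases max_cases x 0 with h2 | h2 <;>
  rcases min_cases (max y 0) 1 with h3 | h3 <;> rcases min_cases (max x 0) 1 with h4 | h4 <;>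
  linarith

lemma rampIntegral_sub (hb : 0 < b) (s u u' : ℝ) :
    rampIntegral b s u' - rampIntegral b s u = ∫ t in u..u', clamp (b * (s - t)) 0 1 := by
  refine (intervalIntegral.integral_eq_sub_of_hasDerivAt
    (fun t _ => hasDerivAt_rampIntegral hb s t) ?_).symm
  exact (continuous_clamp.comp (by fun_prop)).intervalIntegrable _ _

lemma rampIntegral_zero_right {s : ℝ} (hs : 0 ≤ s) : rampIntegral b s 0 = 0 := by
  rw [rampIntegral, sub_zero, sub_zero, max_eq_left hs]
  ring

lemma rampIntegral_zero_left (hb : 0 < b) {u : ℝ} (hu : 0 ≤ u) : rampIntegral b 0 u = 0 := by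
  have hr : 0 < 1 / b := by positivity
  rw [rampIntegral, max_eq_right (by linarith), max_eq_right (by linarith),
    max_eq_right (by linarith)]
  ring

lemma rampIntegral_one_add (hb : 0 < b) {u : ℝ} (hu : u ≤ 1) :
    rampIntegral b (1 + 1 / b) u = u := by
  have hr : 0 < 1 / b := by positivity
  have hbr : b * (1 / b) = 1 := by field_simp
  rw [rampIntegral, max_eq_left (by linarith), max_eq_left (by linarith),
    max_eq_left (by linarith)]
  linear_combination u * hbr

lemma rampIntegral_one_right {s : ℝ} (hs : s ≤ 1 + 1 / b) :
    rampIntegral b s 1 = rampMass b s := by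
  rw [rampIntegral, rampMass, max_eq_right (a := s - 1 / b - 1) (by linarith)]
  ring

/-- The ramp increases with `s`, and `sPar` increases with `v`; together these make `C_b`
two-increasing. -/
lemma rampIntegral_sub_mono (hb : 0 < b) {s s' u u' : ℝ} (hs : s ≤ s') (hu : u ≤ u') :
    rampIntegral b s u' - rampIntegral b s u ≤ rampIntegral b s' u' - rampIntegral b s' u := by
  rw [rampIntegral_sub hb, rampIntegral_sub hb]
  refine intervalIntegral.integral_mono_on hu
    ((continuous_clamp.comp (by fun_prop)).intervalIntegrable _ _)
    ((continuous_clamp.comp (by fun_prop)).intervalIntegrable _ _) fun t _ => ?_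
  exact monotone_clamp (mul_le_mul_of_nonneg_left (by linarith) hb.le)

lemma monotone_rampIntegral (hb : 0 < b) (s : ℝ) : Monotone (rampIntegral b s) := fun u u' hu => by
  rw [← sub_nonneg, rampIntegral_sub hb]
  exact intervalIntegral.integral_nonneg hu fun t _ => (clamp_mem_Icc _).1

lemma isCopula_copC (hb : 0 < b) : IsCopula (copC b) where
  mem_Icc := fun ⟨u, v⟩ => by
    have h0 := monotone_rampIntegral hb (sPar b v) u.2.1
    have h1 := monotone_rampIntegral hb (sPar b v) u.2.2
    rw [rampIntegral_zero_right (sPar_mem_Icc hb v).1] at h0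
    rw [rampIntegral_one_right (sPar_mem_Icc hb v).2, rampMass_sPar hb] at h1
    rw [copC_eq hb]
    exact ⟨h0, h1.trans v.2.2⟩
  grounded_left v := by
    rw [copC_eq hb, Icc.coe_zero, rampIntegral_zero_right (sPar_mem_Icc hb v).1]
  grounded_right u := by
    rw [copC_eq hb, sPar_zero hb, rampIntegral_zero_left hb u.2.1]
  marginal_left u := by
    rw [copC_eq hb, sPar_one hb, rampIntegral_one_add hb u.2.2]
  marginal_right v := by
    rw [copC_eq hb, Icc.coe_one, rampIntegral_one_right (sPar_mem_Icc hb v).2, rampMass_sPar hb]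
  two_increasing u u' v v' hu hv := by
    have := rampIntegral_sub_mono hb (monotone_sPar hb hv) (show (u : ℝ) ≤ u' from hu)
    simp only [copC_eq hb]
    linarith

/-! ### Stochastic monotonicity -/

/-- If `U` and `W` are independent and uniform, then `(U, rampTransform b U W) ∼ C_b`. -/
def rampTransform (b : ℝ) (u w : I) : I := projIcc 0 1 zero_le_one (rampMass b (u + w / b))

lemma continuous_rampTransform (b : ℝ) :
    Continuous fun q : I × I => rampTransform b q.1 q.2 :=
  continuous_projIcc.comp ((continuous_rampMass b).comp (by fun_prop))

lemma add_div_mem_Icc (hb : 0 < b) (u w : I) : (u + w / b : ℝ) ∈ Icc 0 (1 + 1 / b) := by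
  obtain ⟨hu0, hu1⟩ := u.2
  obtain ⟨hw0, hw1⟩ := w.2
  exact ⟨by positivity, by gcongr⟩

/-- The projection onto `[0,1]` in `rampTransform` only fixes the type; it never changes the value.
-/
lemma coe_rampTransform (hb : 0 < b) (u w : I) :
    (rampTransform b u w : ℝ) = rampMass b (u + w / b) := by
  have hm := (strictMonoOn_rampMass hb).monotoneOn
  have h := add_div_mem_Icc hb u w
  have hr : (0 : ℝ) ≤ 1 + 1 / b := by positivity
  refine congrArg Subtype.val (projIcc_of_mem zero_le_one ⟨?_, ?_⟩)
  · rw [← rampMass_zero hb]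
    exact hm ⟨le_rfl, hr⟩ h h.1
  · rw [← rampMass_one_add hb]
    exact hm h ⟨hr, le_rfl⟩ h.2

lemma rampTransform_mono_left (hb : 0 < b) (w : I) : Monotone fun u => rampTransform b u w :=
  fun u u' hu => by
    show (rampTransform b u w : ℝ) ≤ rampTransform b u' w
    rw [coe_rampTransform hb, coe_rampTransform hb]
    exact (strictMonoOn_rampMass hb).monotoneOn (add_div_mem_Icc hb _ _) (add_div_mem_Icc hb _ _)
      (by gcongr)

/-- Applying the inverse of `rampMass` turns the event into a half-line in `w`, whose uniform
probability is `∂₁C_b(t, v)`. -/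
lemma rampTransform_le_iff (hb : 0 < b) (t w v : I) :
    rampTransform b t w ≤ v ↔ (w : ℝ) ≤ b * (sPar b v - t) := by
  rw [← Subtype.coe_le_coe, coe_rampTransform hb]
  conv_lhs => rw [← rampMass_sPar hb v]
  rw [(strictMonoOn_rampMass hb).le_iff_le (add_div_mem_Icc hb t w) (sPar_mem_Icc hb v),
    ← le_sub_iff_add_le', div_le_iff₀' hb]

lemma volume_real_coe_le (y : ℝ) : volume.real {w : I | (w : ℝ) ≤ y} = clamp y 0 1 := by
  rcases lt_or_ge y 0 with h | h
  · have : {w : I | (w : ℝ) ≤ y} = ∅ :=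
      eq_empty_of_forall_notMem fun w hw => (w.2.1.trans hw).not_gt h
    rw [this, measureReal_empty, clamp, max_eq_right h.le, min_eq_left zero_le_one]
  · have hm : min y 1 ∈ Icc (0 : ℝ) 1 := ⟨le_min h zero_le_one, min_le_right _ _⟩
    have : {w : I | (w : ℝ) ≤ y} = Iic ⟨min y 1, hm⟩ := by
      ext w
      exact (le_min_iff.trans (and_iff_left w.2.2)).symm
    rw [this, measureReal_def, unitInterval.volume_Iic, ENNReal.toReal_ofReal hm.1, clamp,
      max_eq_left h]

/-- The law of a random vector with copula `C_b`. -/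
def copCLaw (b : ℝ) : Measure (I × I) :=
  (volume : Measure (I × I)).map fun q => (q.1, rampTransform b q.1 q.2)

/-- The conditional law of the second coordinate given the first one under `copCLaw b`. -/
def copCKernel (b : ℝ) : ProbabilityTheory.Kernel I I where
  toFun u := (volume : Measure I).map (rampTransform b u)
  measurable' := by
    refine Measure.measurable_of_measurable_coe _ fun s hs => ?_
    have hm := (continuous_rampTransform b).measurable
    have : (fun u => (volume : Measure I).map (rampTransform b u) s) =
        fun u => volume (Prod.mk u ⁻¹' ((fun q : I × I => rampTransform b q.1 q.2) ⁻¹' s)) := by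
      funext u
      exact Measure.map_apply (hm.comp measurable_prodMk_left) hs
    rw [this]
    exact measurable_measure_prodMk_left (hm hs)

lemma measurable_rampTransform_right (b : ℝ) (u : I) : Measurable (rampTransform b u) :=
  Measurable.comp (g := fun q : I × I => rampTransform b q.1 q.2) (f := Prod.mk u)
    (continuous_rampTransform b).measurable measurable_prodMk_left

lemma measurable_prodMk_rampTransform (b : ℝ) :
    Measurable fun q : I × I => (q.1, rampTransform b q.1 q.2) :=
  measurable_fst.prodMk (continuous_rampTransform b).measurable

instance (b : ℝ) : ProbabilityTheory.IsMarkovKernel (copCKernel b) :=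
  ⟨fun u => Measure.isProbabilityMeasure_map (measurable_rampTransform_right b u).aemeasurable⟩

instance (b : ℝ) : IsProbabilityMeasure (copCLaw b) :=
  Measure.isProbabilityMeasure_map (measurable_prodMk_rampTransform b).aemeasurable

lemma copCLaw_apply (b : ℝ) {s : Set (I × I)} (hs : MeasurableSet s) :
    copCLaw b s = ∫⁻ t : I, volume {w : I | (t, rampTransform b t w) ∈ s} := by
  rw [copCLaw, Measure.map_apply (measurable_prodMk_rampTransform b) hs, Measure.volume_eq_prod,
    Measure.prod_apply (measurable_prodMk_rampTransform b hs)]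
  rfl

lemma copCLaw_fst (b : ℝ) : (copCLaw b).fst = volume := by
  rw [Measure.fst, copCLaw, Measure.map_map measurable_fst (measurable_prodMk_rampTransform b),
    Measure.volume_eq_prod]
  exact Measure.fst_prod

lemma copCLaw_eq_compProd (b : ℝ) : copCLaw b = (copCLaw b).fst.compProd (copCKernel b) := by
  ext s hs
  rw [copCLaw_fst, Measure.compProd_apply hs, copCLaw_apply b hs]
  refine lintegral_congr fun t => ?_
  exact (Measure.map_apply (measurable_rampTransform_right b t) (measurable_prodMk_left hs)).symm

lemma hasLaw_copC (hb : 0 < b) : HasLaw (copC b) (copCLaw b) := fun u v => by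
  have h1 : ∀ t : I, volume {w : I | (t, rampTransform b t w) ∈ Iic u ×ˢ Iic v} =
      (Iic u).indicator (fun t : I => ENNReal.ofReal (partialOne (copC b) t v)) t := fun t => by
    by_cases ht : t ∈ Iic u
    · rw [indicator_of_mem ht, partialOne_copC hb, ← volume_real_coe_le, ofReal_measureReal]
      congr 1
      ext w
      exact (and_iff_right ht).trans (rampTransform_le_iff hb t w v)
    · rw [indicator_of_notMem ht]
      convert measure_empty (μ := (volume : Measure I))
      exact eq_empty_of_forall_notMem fun w hw => ht hw.1
  have hm : Measurable fun t : I => partialOne (copC b) t v := by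
    simp only [partialOne_copC hb]
    exact (continuous_clamp.comp (by fun_prop)).measurable
  rw [measureReal_def, copCLaw_apply b (measurableSet_Iic.prod measurableSet_Iic),
    lintegral_congr h1, lintegral_indicator measurableSet_Iic,
    ← ofReal_integral_eq_lintegral_ofReal
      (integrable_of_bounded hm.aestronglyMeasurable 1 fun t =>
        (isCopula_copC hb).abs_partialOne_le_one t v)
      (ae_of_all _ fun t => (isCopula_copC hb).partialOne_nonneg t v),
    (isCopula_copC hb).setIntegral_partialOne,
    ENNReal.toReal_ofReal ((isCopula_copC hb).mem_Icc _).1]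

/-- Disintegration is unique up to a null set, so `condKernel` agrees with `copCKernel b` almost
everywhere. For the latter, monotonicity holds for each fixed `w`, since `rampTransform` increases
in `u`. -/
lemma isSI_copC (hb : 0 < b) : IsSI (copC b) := by
  refine ⟨isCopula_copC hb, copCLaw b, inferInstance, hasLaw_copC hb, fun v => ?_⟩
  have h := ProbabilityTheory.eq_condKernel_of_measure_eq_compProd (copCKernel b)
    (copCLaw_eq_compProd b)
  rw [copCLaw_fst] at h
  refine ⟨{u | ¬ copCKernel b u = (copCLaw b).condKernel u}, h, fun u hu u' hu' huu' => ?_⟩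
  simp only [mem_compl_iff, mem_ofPred_eq, not_not] at hu hu'
  simp only [← hu, ← hu']
  have e : ∀ x, copCKernel b x = (volume : Measure I).map (rampTransform b x) := fun _ => rfl
  rw [e, e, map_measureReal_apply (measurable_rampTransform_right b _) measurableSet_Ici,
    map_measureReal_apply (measurable_rampTransform_right b _) measurableSet_Ici]
  exact measureReal_mono (μ := (volume : Measure I)) fun w hw =>
    (show v ≤ _ from hw).trans (rampTransform_mono_left hb w huu')

/-! ### The limits `b → 0` and `b → ∞` -/

lemma abs_clamp_sub_clamp_le (x y : ℝ) : |clamp y 0 1 - clamp x 0 1| ≤ |y - x| := by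
  rcases le_total x y with h | h
  · rw [abs_of_nonneg (sub_nonneg.2 (monotone_clamp h)), abs_of_nonneg (sub_nonneg.2 h)]
    exact clamp_sub_clamp_le h
  · rw [abs_sub_comm, abs_sub_comm y, abs_of_nonneg (sub_nonneg.2 (monotone_clamp h)),
      abs_of_nonneg (sub_nonneg.2 h)]
    exact clamp_sub_clamp_le h

lemma copC_eq_integral (hb : 0 < b) (u v : I) :
    copC b (u, v) = ∫ t in (0 : ℝ)..u, clamp (b * (sPar b v - t)) 0 1 := by
  rw [← rampIntegral_sub hb, rampIntegral_zero_right (sPar_mem_Icc hb v).1, sub_zero, copC_eq hb]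

lemma intervalIntegrable_clamp (b s x y : ℝ) :
    IntervalIntegrable (fun t => clamp (b * (s - t)) 0 1) volume x y :=
  (continuous_clamp.comp (by fun_prop)).intervalIntegrable _ _

/-- The ramp is `b`-Lipschitz in `t` and has mean `v` over `[0,1]`, so it stays within `b` of `v`.
-/
lemma abs_sub_clamp_le (hb : 0 < b) (v : I) {t : ℝ} (ht : t ∈ Icc (0 : ℝ) 1) :
    |v - clamp (b * (sPar b v - t)) 0 1| ≤ b := by
  have h1 := copC_eq_integral hb 1 v
  rw [(isCopula_copC hb).marginal_right, Icc.coe_one] at h1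
  have h2 : v - clamp (b * (sPar b v - t)) 0 1 = ∫ x in (0 : ℝ)..1,
      (clamp (b * (sPar b v - x)) 0 1 - clamp (b * (sPar b v - t)) 0 1) := by
    rw [intervalIntegral.integral_sub (intervalIntegrable_clamp _ _ _ _)
      intervalIntegrable_const, ← h1]
    simp
  rw [h2, ← Real.norm_eq_abs]
  refine (intervalIntegral.norm_integral_le_of_norm_le_const (C := b) fun x hx => ?_).trans
    (by simp)
  rw [uIoc_of_le zero_le_one] at hx
  refine (abs_clamp_sub_clamp_le _ _).trans ?_
  rw [show b * (sPar b v - x) - b * (sPar b v - t) = b * (t - x) by ring, abs_mul, abs_of_pos hb]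
  exact mul_le_of_le_one_right hb.le
    (abs_le.2 ⟨by linarith [ht.1, hx.2], by linarith [ht.2, hx.1]⟩)

lemma abs_copPi_sub_copC_le (hb : 0 < b) (p : I × I) : |copPi p - copC b p| ≤ b := by
  obtain ⟨u, v⟩ := p
  have h : copPi (u, v) - copC b (u, v) =
      ∫ t in (0 : ℝ)..u, ((v : ℝ) - clamp (b * (sPar b v - t)) 0 1) := by
    rw [intervalIntegral.integral_sub intervalIntegrable_const (intervalIntegrable_clamp _ _ _ _),
      copC_eq_integral hb]
    simp [copPi]
  rw [h, ← Real.norm_eq_abs]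
  refine (intervalIntegral.norm_integral_le_of_norm_le_const (C := b) fun t ht => ?_).trans ?_
  · rw [uIoc_of_le u.2.1] at ht
    exact abs_sub_clamp_le hb v ⟨ht.1.le, ht.2.trans u.2.2⟩
  · rw [sub_zero]
    exact mul_le_of_le_one_right hb.le (abs_coe_le_one u)

lemma copM_sub_copC_le (hb : 0 < b) (p : I × I) : copM p - copC b p ≤ 1 / b := by
  obtain ⟨u, v⟩ := p
  have hmin : copM (u, v) ≤ u := min_le_left _ _
  have hmin' : copM (u, v) ≤ v := min_le_right _ _
  have hr : 0 < 1 / b := by positivity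
  have hs := sPar_mem_Icc hb v
  unfold copC
  simp only
  split_ifs with h1 h2
  · linarith
  · rw [not_le] at h1
    have ha : sPar b v - 1 / b ≤ aPar b v := le_max_left _ _
    -- The expression factors as `(u - a)(2s - a - u)/2`, hence `C_b ≥ a ≥ s - 1/b ≥ u - 1/b` on the
    -- ramp.
    have h3 : 0 ≤ sPar b v * (u - aPar b v) + (aPar b v ^ 2 - (u : ℝ) ^ 2) / 2 := by
      have h4 := mul_nonneg (sub_nonneg.2 h1.le)
        (show 0 ≤ 2 * sPar b v - aPar b v - u by linarith)
      linarith
    have := mul_nonneg hb.le h3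
    linarith
  · linarith

lemma tendstoUniformly_copC_copPi : TendstoUniformly copC copPi (𝓝[>] 0) := by
  refine Metric.tendstoUniformly_iff.2 fun ε hε => ?_
  filter_upwards [Ioo_mem_nhdsGT hε] with b hb p
  exact (abs_copPi_sub_copC_le hb.1 p).trans_lt hb.2

lemma tendstoUniformly_copC_copM : TendstoUniformly copC copM atTop := by
  refine Metric.tendstoUniformly_iff.2 fun ε hε => ?_
  filter_upwards [eventually_gt_atTop (1 / ε)] with b hb p
  have hb0 : 0 < b := lt_trans (by positivity) hb
  have h0 := (isCopula_copC hb0).le_min p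
  rw [Real.dist_eq, abs_of_nonneg (by linarith)]
  refine (copM_sub_copC_le hb0 p).trans_lt ?_
  rwa [one_div_lt hb0 hε]

/-! ### The independence copula -/

lemma isCopula_copPi : IsCopula copPi where
  mem_Icc p := ⟨mul_nonneg p.1.2.1 p.2.2.1, mul_le_one₀ p.1.2.2 p.2.2.1 p.2.2.2⟩
  grounded_left v := by simp [copPi]
  grounded_right u := by simp [copPi]
  marginal_left u := by simp [copPi]
  marginal_right v := by simp [copPi]
  two_increasing u u' v v' hu hv := by
    have := mul_nonneg (sub_nonneg.2 (show (u : ℝ) ≤ u' from hu))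
      (sub_nonneg.2 (show (v : ℝ) ≤ v' from hv))
    simp only [copPi]
    linarith

lemma partialOne_copPi (t v : I) : partialOne copPi t v = v := by
  have h : ∀ x ∈ Icc (0 : ℝ) 1, firstSection copPi v x = x * v :=
    fun x hx => IsCopula.firstSection_coe copPi ⟨x, hx⟩ v
  have h1 : HasDerivWithinAt (fun x : ℝ => x * (v : ℝ)) v (Icc 0 1) t := by
    simpa using (hasDerivAt_mul_const (v : ℝ)).hasDerivWithinAt (x := (t : ℝ)) (s := Icc 0 1)
  exact (h1.congr h (h t t.2)).derivWithin (uniqueDiffOn_Icc zero_lt_one _ t.2)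

lemma integral_coe_sq : ∫ v : I, (v : ℝ) ^ 2 = 1 / 3 := by
  rw [integral_coe_unitInterval fun v => v ^ 2]
  simp
  norm_num

lemma chatterjeeXi_copPi : chatterjeeXi copPi = 0 := by
  rw [chatterjeeXi]
  simp only [partialOne_copPi, integral_const, probReal_univ, one_smul, integral_coe_sq]
  norm_num

lemma spearmanRho_copPi : spearmanRho copPi = 0 := by
  have h : ∫ v : I, (v : ℝ) = 1 / 2 := by
    rw [integral_coe_unitInterval fun v => v]
    simp
  have : ∫ p : I × I, copPi p = 1 / 4 := by
    unfold copPi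
    rw [Measure.volume_eq_prod, integral_prod_mul (fun u : I => (u : ℝ)) fun v : I => (v : ℝ), h]
    norm_num
  rw [spearmanRho, this]
  norm_num

/-- The marginals fix `∫ v ∂₁D = 1/3`, so `∫ (∂₁D - v)² = ∫ (∂₁D)² - 1/3`, which is `ξ(D)/6`. -/
lemma IsCopula.eq_copPi_of_chatterjeeXi {D : I × I → ℝ} (hD : IsCopula D)
    (h : chatterjeeXi D = 0) : D = copPi := by
  refine isCopula_copPi.eq_of_integral_sq_nonpos hD (le_of_eq ?_)
  have h1 := hD.integrable_partialOne_sq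
  have h2 := isCopula_copPi.integrable_partialOne_sq
  have h3 := hD.integrable_mul_partialOne (g := fun p => (p.2 : ℝ)) (by fun_prop) 1
    fun p => abs_coe_le_one _
  have h4 : ∫ p : I × I, (p.2 : ℝ) * partialOne D p.1 p.2 = 1 / 3 := by
    rw [hD.integral_mul_snd measurable_subtype_coe 1 abs_coe_le_one, ← integral_coe_sq]
    simp only [pow_two]
  have h5 := hD.chatterjeeXi_eq
  have h6 := isCopula_copPi.chatterjeeXi_eq
  rw [h] at h5
  rw [chatterjeeXi_copPi] at h6
  have h7 : ∀ p : I × I, (partialOne D p.1 p.2 - partialOne copPi p.1 p.2) ^ 2 =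
      partialOne D p.1 p.2 ^ 2 - 2 * ((p.2 : ℝ) * partialOne D p.1 p.2)
        + partialOne copPi p.1 p.2 ^ 2 := fun p => by
    rw [partialOne_copPi]
    ring
  simp only [h7]
  rw [integral_add (h1.sub' (h3.const_mul 2)) h2, integral_sub h1 (h3.const_mul 2),
    integral_const_mul, h4]
  linarith

lemma isUniqueMaximizer_copPi : IsUniqueMaximizer 0 copPi :=
  ⟨⟨isCopula_copPi, chatterjeeXi_copPi, fun _ hD h =>
    (congrArg spearmanRho (hD.eq_copPi_of_chatterjeeXi h)).le⟩,
    fun _ hD => hD.1.eq_copPi_of_chatterjeeXi hD.2.1⟩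

/-! ### The upper Fréchet copula -/

lemma isCopula_copM : IsCopula copM where
  mem_Icc p := ⟨le_min p.1.2.1 p.2.2.1, (min_le_left _ _).trans p.1.2.2⟩
  grounded_left v := min_eq_left v.2.1
  grounded_right u := min_eq_right u.2.1
  marginal_left u := min_eq_left u.2.2
  marginal_right v := min_eq_right v.2.2
  two_increasing u u' v v' hu hv := by
    have hu' : (u : ℝ) ≤ u' := hu
    have hv' : (v : ℝ) ≤ v' := hv
    simp only [copM]
    rcases min_cases (u : ℝ) v with h1 | h1 <;> rcases min_cases (u' : ℝ) v' with h2 | h2 <;>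
    rcases min_cases (u : ℝ) v' with h3 | h3 <;> rcases min_cases (u' : ℝ) v with h4 | h4 <;>
    linarith

lemma firstSection_copM (v : I) {x : ℝ} (hx : x ∈ Icc (0 : ℝ) 1) :
    firstSection copM v x = min x v :=
  IsCopula.firstSection_coe copM ⟨x, hx⟩ v

/-- Off the diagonal the derivative is `0` or `1`, so squaring does not change its integral `v`;
this gives `ξ(M) = 1`. -/
lemma partialOne_copM_sq {t v : I} (h : t ≠ v) : partialOne copM t v ^ 2 = partialOne copM t v := by
  have hd : ∀ d : ℝ, HasDerivAt (fun x : ℝ => min x v) d t → partialOne copM t v = d :=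
    fun d hd => (hd.hasDerivWithinAt.congr (fun x hx => firstSection_copM v hx)
      (firstSection_copM v t.2)).derivWithin (uniqueDiffOn_Icc zero_lt_one _ t.2)
  rcases lt_or_gt_of_ne h with h | h
  · rw [hd 1, one_pow]
    refine (hasDerivAt_id (t : ℝ)).congr_of_eventuallyEq ?_
    filter_upwards [gt_mem_nhds (show (t : ℝ) < v from h)] with x hx
    exact min_eq_left (le_of_lt hx)
  · rw [hd 0, zero_pow two_ne_zero]
    refine (hasDerivAt_const (t : ℝ) (v : ℝ)).congr_of_eventuallyEq ?_
    filter_upwards [lt_mem_nhds (show (v : ℝ) < t from h)] with x hx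
    exact min_eq_right (le_of_lt hx)

lemma chatterjeeXi_copM : chatterjeeXi copM = 1 := by
  have h : ∀ v : I, ∫ t : I, partialOne copM t v ^ 2 = v := fun v => by
    rw [← isCopula_copM.integral_partialOne v]
    refine integral_congr_ae ?_
    filter_upwards [compl_mem_ae_iff.2 (measure_singleton v)] with t ht
    exact partialOne_copM_sq ht
  rw [chatterjeeXi]
  simp only [h]
  rw [integral_coe_unitInterval fun v => v]
  simp
  norm_num

lemma integral_min (v : I) : ∫ u : I, min (u : ℝ) v = 1 / 2 - (1 - (v : ℝ)) ^ 2 / 2 := by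
  have hd : ∀ x : ℝ, HasDerivAt (fun x : ℝ => x ^ 2 / 2 - max (x - v) 0 ^ 2 / 2) (min x v) x :=
    fun x => by
      refine (((hasDerivAt_pow 2 x).div_const 2).sub
        ((hasDerivAt_posPart_sub_pow 0 v x).div_const 2)).congr_deriv ?_
      rcases le_total x v with h | h
      · rw [min_eq_left h, max_eq_right (by linarith)]; simp
      · rw [min_eq_right h, max_eq_left (by linarith)]; simp
  rw [integral_coe_unitInterval fun u => min u v,
    intervalIntegral.integral_eq_sub_of_hasDerivAt (fun x _ => hd x)
      ((continuous_id.min continuous_const).intervalIntegrable _ _),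
    max_eq_left (sub_nonneg.2 v.2.2), max_eq_right (by linarith [v.2.1])]
  simp

lemma IsCopula.integrable {C : I × I → ℝ} (h : IsCopula C) : Integrable C :=
  integrable_of_bounded h.continuous.aestronglyMeasurable 1 fun p =>
    abs_le.2 ⟨by linarith [(h.mem_Icc p).1], (h.mem_Icc p).2⟩

lemma spearmanRho_copM : spearmanRho copM = 1 := by
  have h := isCopula_copM.integrable
  have h1 : ∫ p : I × I, copM p = 1 / 3 := by
    rw [Measure.volume_eq_prod] at h ⊢
    rw [integral_prod_symm _ h]
    simp only [copM, integral_min]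
    rw [integral_coe_unitInterval fun v => 1 / 2 - (1 - v) ^ 2 / 2,
      intervalIntegral.integral_sub (by simp) (Continuous.intervalIntegrable (by fun_prop) _ _),
      intervalIntegral.integral_comp_sub_left (fun x : ℝ => x ^ 2 / 2) 1]
    simp
    norm_num
  rw [spearmanRho, h1]
  norm_num

lemma IsCopula.spearmanRho_le_one {D : I × I → ℝ} (hD : IsCopula D) : spearmanRho D ≤ 1 := by
  rw [← spearmanRho_copM, spearmanRho, spearmanRho]
  have := integral_mono hD.integrable isCopula_copM.integrable hD.le_min
  linarith

/-- Since `D ≤ M` pointwise, equal integrals force equality almost everywhere, and continuity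
everywhere. -/
lemma IsCopula.eq_copM_of_spearmanRho {D : I × I → ℝ} (hD : IsCopula D)
    (h : 1 ≤ spearmanRho D) : D = copM := by
  rw [← spearmanRho_copM, spearmanRho, spearmanRho] at h
  have h0 : ∫ p, (copM p - D p) = 0 := by
    have := integral_mono hD.integrable isCopula_copM.integrable hD.le_min
    rw [integral_sub isCopula_copM.integrable hD.integrable]
    linarith
  have h1 := (integral_eq_zero_iff_of_nonneg (fun p => sub_nonneg.2 (hD.le_min p))
    (isCopula_copM.integrable.sub' hD.integrable)).1 h0
  rw [Measure.volume_eq_prod] at h1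
  refine (hD.continuous.ae_eq_iff_eq ((volume : Measure I).prod volume)
    isCopula_copM.continuous).1 ?_
  filter_upwards [h1] with p hp
  exact (sub_eq_zero.1 hp).symm

lemma isUniqueMaximizer_copM : IsUniqueMaximizer 1 copM :=
  ⟨⟨isCopula_copM, chatterjeeXi_copM, fun D hD _ => by
    rw [spearmanRho_copM]; exact hD.spearmanRho_le_one⟩,
    fun D hD => hD.1.eq_copM_of_spearmanRho (by
      rw [← spearmanRho_copM]; exact hD.2.2 _ isCopula_copM chatterjeeXi_copM)⟩

/-! ### Integrals of products of positive parts -/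

lemma integral_quartic (x y c₀ c₁ c₂ c₃ c₄ : ℝ) :
    ∫ s in x..y, (c₀ + c₁ * s + c₂ * s ^ 2 + c₃ * s ^ 3 + c₄ * s ^ 4) =
      c₀ * (y - x) + c₁ * (y ^ 2 - x ^ 2) / 2 + c₂ * (y ^ 3 - x ^ 3) / 3 +
        c₃ * (y ^ 4 - x ^ 4) / 4 + c₄ * (y ^ 5 - x ^ 5) / 5 := by
  have hd : ∀ s : ℝ, HasDerivAt (fun s : ℝ => c₀ * s + c₁ * (s ^ 2 / 2) + c₂ * (s ^ 3 / 3) +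
      c₃ * (s ^ 4 / 4) + c₄ * (s ^ 5 / 5)) (c₀ + c₁ * s + c₂ * s ^ 2 + c₃ * s ^ 3 + c₄ * s ^ 4) s :=
    fun s => by
      have h := (((((hasDerivAt_id s).const_mul c₀).add
        (((hasDerivAt_pow 2 s).div_const 2).const_mul c₁)).add
        (((hasDerivAt_pow 3 s).div_const 3).const_mul c₂)).add
        (((hasDerivAt_pow 4 s).div_const 4).const_mul c₃)).add
        (((hasDerivAt_pow 5 s).div_const 5).const_mul c₄)
      refine h.congr_deriv ?_
      norm_num
  rw [intervalIntegral.integral_eq_sub_of_hasDerivAt (fun s _ => hd s)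
    (Continuous.intervalIntegrable (by fun_prop) _ _)]
  ring

lemma integral_eq_of_quartic {f : ℝ → ℝ} {x y : ℝ} (hxy : x ≤ y) (c₀ c₁ c₂ c₃ c₄ : ℝ)
    (h : ∀ s ∈ Icc x y, f s = c₀ + c₁ * s + c₂ * s ^ 2 + c₃ * s ^ 3 + c₄ * s ^ 4) :
    ∫ s in x..y, f s =
      c₀ * (y - x) + c₁ * (y ^ 2 - x ^ 2) / 2 + c₂ * (y ^ 3 - x ^ 3) / 3 +
        c₃ * (y ^ 4 - x ^ 4) / 4 + c₄ * (y ^ 5 - x ^ 5) / 5 := by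
  rw [← integral_quartic]
  exact intervalIntegral.integral_congr fun s hs => h s (by rwa [uIcc_of_le hxy] at hs)

/-- The trapezoidal weight with breakpoints `0, α, β, α + β`. -/
def trapezoid (α β s : ℝ) : ℝ := s - max (s - α) 0 - max (s - β) 0

lemma trapezoid_comm (α β s : ℝ) : trapezoid α β s = trapezoid β α s := by
  unfold trapezoid; ring

lemma continuous_trapezoid (α β : ℝ) : Continuous (trapezoid α β) := by
  unfold trapezoid; fun_prop

section

variable {α β : ℝ}

/-- Cutting at `α` and `β` makes every positive part linear on each piece, so the integrals below
reduce to polynomials of degree at most four. -/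
lemma integral_trapezoid_mul {f : ℝ → ℝ} (hf : Continuous f) (hα : 0 ≤ α) (hαβ : α ≤ β) :
    ∫ s in (0 : ℝ)..α + β, trapezoid α β s * f s =
      (∫ s in (0 : ℝ)..α, s * f s) + (∫ s in α..β, α * f s) +
        ∫ s in β..α + β, (α + β - s) * f s := by
  have hi : ∀ x y, IntervalIntegrable (fun s => trapezoid α β s * f s) volume x y := fun x y =>
    ((continuous_trapezoid α β).mul hf).intervalIntegrable x y
  rw [← intervalIntegral.integral_add_adjacent_intervals (hi 0 β) (hi β (α + β)),
    ← intervalIntegral.integral_add_adjacent_intervals (hi 0 α) (hi α β)]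
  congr 1
  · congr 1
    · refine intervalIntegral.integral_congr fun s hs => ?_
      rw [uIcc_of_le hα] at hs
      simp only [trapezoid]
      rw [max_eq_right (by linarith [hs.2]), max_eq_right (by linarith [hs.2])]
      ring
    · refine intervalIntegral.integral_congr fun s hs => ?_
      rw [uIcc_of_le hαβ] at hs
      simp only [trapezoid]
      rw [max_eq_left (by linarith [hs.1]), max_eq_right (by linarith [hs.2])]
      ring
  · refine intervalIntegral.integral_congr fun s hs => ?_
    rw [uIcc_of_le (by linarith)] at hs
    simp only [trapezoid]
    rw [max_eq_left (by linarith [hs.1]), max_eq_left (by linarith [hs.1])]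
    ring

lemma integral_trapezoid_mul_sq (hα : 0 ≤ α) (hαβ : α ≤ β) :
    ∫ s in (0 : ℝ)..α + β, trapezoid α β s * s ^ 2 =
      α * β ^ 3 / 3 + α ^ 2 * β ^ 2 / 2 + α ^ 3 * β / 3 := by
  rw [integral_trapezoid_mul (by fun_prop) hα hαβ,
    integral_eq_of_quartic hα 0 0 0 1 0 fun s _ => by ring,
    integral_eq_of_quartic hαβ 0 0 α 0 0 fun s _ => by ring,
    integral_eq_of_quartic (by linarith) 0 0 (α + β) (-1) 0 fun s _ => by ring]
  ring

lemma integral_trapezoid_mul_cubes (hα : 0 ≤ α) (hαβ : α ≤ β) :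
    ∫ s in (0 : ℝ)..α + β,
        trapezoid α β s * (s ^ 3 - max (s - α) 0 ^ 3 - max (s - β) 0 ^ 3) =
      α ^ 2 * β ^ 3 + α ^ 4 * β / 2 - α ^ 5 / 10 := by
  rw [integral_trapezoid_mul (by fun_prop) hα hαβ,
    integral_eq_of_quartic hα 0 0 0 0 1 fun s hs => by
      rw [max_eq_right (by linarith [hs.2]), max_eq_right (by linarith [hs.2])]
      ring,
    integral_eq_of_quartic hαβ (α ^ 4) (-3 * α ^ 3) (3 * α ^ 2) 0 0 fun s hs => by
      rw [max_eq_left (by linarith [hs.1]), max_eq_right (by linarith [hs.2])]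
      ring,
    integral_eq_of_quartic (by linarith) ((α + β) * (α ^ 3 + β ^ 3))
      (-(3 * (α + β) * (α ^ 2 + β ^ 2) + (α ^ 3 + β ^ 3)))
      (3 * (α + β) ^ 2 + 3 * (α ^ 2 + β ^ 2)) (-4 * (α + β)) 1 fun s hs => by
      rw [max_eq_left (by linarith [hs.1]), max_eq_left (by linarith [hs.1])]
      ring]
  ring

lemma integral_trapezoid_mul_left_sq (hα : 0 ≤ α) (hαβ : α ≤ β) :
    ∫ s in (0 : ℝ)..α + β, trapezoid α β s * max (s - α) 0 ^ 2 =
      α * β ^ 3 / 3 - α ^ 2 * β ^ 2 / 2 + α ^ 3 * β / 3 - α ^ 4 / 12 := by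
  rw [integral_trapezoid_mul (by fun_prop) hα hαβ,
    integral_eq_of_quartic hα 0 0 0 0 0 fun s hs => by
      rw [max_eq_right (by linarith [hs.2])]
      ring,
    integral_eq_of_quartic hαβ (α ^ 3) (-2 * α ^ 2) α 0 0 fun s hs => by
      rw [max_eq_left (by linarith [hs.1])]
      ring,
    integral_eq_of_quartic (by linarith) ((α + β) * α ^ 2) (-(2 * α * (α + β) + α ^ 2))
      (α + β + 2 * α) (-1) 0 fun s hs => by
      rw [max_eq_left (by linarith [hs.1])]
      ring]
  ring

lemma integral_trapezoid_mul_right_sq (hα : 0 ≤ α) (hαβ : α ≤ β) :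
    ∫ s in (0 : ℝ)..α + β, trapezoid α β s * max (s - β) 0 ^ 2 = α ^ 4 / 12 := by
  rw [integral_trapezoid_mul (by fun_prop) hα hαβ,
    integral_eq_of_quartic hα 0 0 0 0 0 fun s hs => by
      rw [max_eq_right (by linarith [hs.2])]
      ring,
    integral_eq_of_quartic hαβ 0 0 0 0 0 fun s hs => by
      rw [max_eq_right (by linarith [hs.2])]
      ring,
    integral_eq_of_quartic (by linarith) ((α + β) * β ^ 2) (-(2 * β * (α + β) + β ^ 2))
      (α + β + 2 * β) (-1) 0 fun s hs => by
      rw [max_eq_left (by linarith [hs.1])]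
      ring]
  ring

end

/-! ### The values of `ξ` and `ρ` at `C_b` -/

/-- Substitution `v = rampMass b s`: the density `rampMassDeriv b s` is `b` times the trapezoid.
This removes the square roots of `sPar` from the integrals. -/
lemma integral_comp_sPar (hb : 0 < b) (F : ℝ → ℝ) :
    ∫ v : I, F (sPar b v) = ∫ s in (0 : ℝ)..1 + 1 / b, b * (trapezoid 1 (1 / b) s * F s) := by
  have hr : (0 : ℝ) ≤ 1 + 1 / b := by positivity
  have hmono := strictMonoOn_rampMass hb
  have himage : rampMass b '' Icc 0 (1 + 1 / b) = Icc 0 1 := by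
    refine Subset.antisymm ?_ fun v hv => ⟨sPar b v, sPar_spec hb hv⟩
    rintro _ ⟨s, hs, rfl⟩
    rw [← rampMass_zero hb, ← rampMass_one_add hb]
    exact ⟨hmono.monotoneOn ⟨le_rfl, hr⟩ hs hs.1, hmono.monotoneOn hs ⟨hr, le_rfl⟩ hs.2⟩
  rw [integral_coe_unitInterval fun v => F (sPar b v),
    intervalIntegral.integral_of_le zero_le_one, ← integral_Icc_eq_integral_Ioc, ← himage,
    integral_image_eq_integral_abs_deriv_smul measurableSet_Icc
      (fun s _ => (hasDerivAt_rampMass b s).hasDerivWithinAt) hmono.injOn,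
    -- Passing to the open interval, since the density vanishes at both endpoints and is positive
    -- only inside.
    intervalIntegral.integral_of_le hr, integral_Icc_eq_integral_Ioc, integral_Ioc_eq_integral_Ioo,
    integral_Ioc_eq_integral_Ioo]
  refine setIntegral_congr_fun measurableSet_Ioo fun s hs => ?_
  have hs' := Ioo_subset_Icc_self hs
  have hv : rampMass b s ∈ Icc (0 : ℝ) 1 := himage ▸ mem_image_of_mem _ hs'
  obtain ⟨h1, h2⟩ := sPar_spec hb hv
  simp only [smul_eq_mul]
  rw [abs_of_pos (rampMassDeriv_pos hb hs), hmono.injOn h1 hs' h2, rampMassDeriv, trapezoid]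
  ring

lemma integral_clamp_sq (hb : 0 < b) {s : ℝ} (hs : s ∈ Icc 0 (1 + 1 / b)) :
    ∫ t in (0 : ℝ)..1, clamp (b * (s - t)) 0 1 ^ 2 =
      b ^ 2 / 3 * (s ^ 3 - max (s - 1) 0 ^ 3 - max (s - 1 / b) 0 ^ 3)
        - b * max (s - 1 / b) 0 ^ 2 := by
  have hbr : b * (1 / b) = 1 := by field_simp
  have hsq : ∀ x : ℝ, clamp (b * x) 0 1 ^ 2 =
      b ^ 2 * (max x 0 ^ 2 - max (x - 1 / b) 0 ^ 2) - 2 * b * max (x - 1 / b) 0 := fun x => by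
    rw [clamp_mul_eq hb]
    have hr : 0 < 1 / b := by positivity
    generalize 1 / b = r at *
    rcases le_total x 0 with h0 | h0
    · rw [max_eq_right h0, max_eq_right (by linarith)]; ring
    · rcases le_total x r with h1 | h1
      · rw [max_eq_left h0, max_eq_right (by linarith)]; ring
      · rw [max_eq_left h0, max_eq_left (by linarith)]
        linear_combination (-2 * b * (x - r)) * hbr
  have hd : ∀ t : ℝ, HasDerivAt (fun t : ℝ => b ^ 2 / 3 *
      (max (s - 1 / b - t) 0 ^ 3 - max (s - t) 0 ^ 3) + b * max (s - 1 / b - t) 0 ^ 2)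
      (clamp (b * (s - t)) 0 1 ^ 2) t := fun t => by
    refine ((((hasDerivAt_posPart_const_sub_pow 1 (s - 1 / b) t).sub
      (hasDerivAt_posPart_const_sub_pow 1 s t)).const_mul (b ^ 2 / 3)).add
      ((hasDerivAt_posPart_const_sub_pow 0 (s - 1 / b) t).const_mul b)).congr_deriv ?_
    rw [hsq, show s - t - 1 / b = s - 1 / b - t by ring]
    norm_num
    ring
  rw [intervalIntegral.integral_eq_sub_of_hasDerivAt (fun t _ => hd t)
      (((continuous_clamp.comp (by fun_prop)).pow 2).intervalIntegrable _ _),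
    max_eq_right (a := s - 1 / b - 1) (by linarith [hs.2]), sub_zero, sub_zero, max_eq_left hs.1]
  ring

lemma integral_rampIntegral {s : ℝ} (hs : s ∈ Icc 0 (1 + 1 / b)) :
    ∫ u in (0 : ℝ)..1, rampIntegral b s u =
      b / 2 * (s ^ 2 - 1 / 3 * (s ^ 3 - max (s - 1) 0 ^ 3 - max (s - 1 / b) 0 ^ 3)
        - max (s - 1 / b) 0 ^ 2) := by
  have hd : ∀ t : ℝ, HasDerivAt (fun t : ℝ => b / 2 * (s ^ 2 * t + max (s - t) 0 ^ 3 / 3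
      - max (s - 1 / b) 0 ^ 2 * t - max (s - 1 / b - t) 0 ^ 3 / 3)) (rampIntegral b s t) t :=
    fun t => by
      refine ((((((hasDerivAt_id t).const_mul (s ^ 2)).add
        ((hasDerivAt_posPart_const_sub_pow 1 s t).div_const 3)).sub
        ((hasDerivAt_id t).const_mul (max (s - 1 / b) 0 ^ 2))).sub
        ((hasDerivAt_posPart_const_sub_pow 1 (s - 1 / b) t).div_const 3)).const_mul
        (b / 2)).congr_deriv ?_
      rw [rampIntegral]
      push_cast
      ring
  rw [intervalIntegral.integral_eq_sub_of_hasDerivAt (fun t _ => hd t)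
      (Continuous.intervalIntegrable (by unfold rampIntegral; fun_prop) _ _),
    max_eq_right (a := s - 1 / b - 1) (by linarith [hs.2]), sub_zero, sub_zero, max_eq_left hs.1]
  ring

lemma chatterjeeXi_copC_eq (hb : 0 < b) :
    chatterjeeXi (copC b) =
      2 * b ^ 3 * (∫ s in (0 : ℝ)..1 + 1 / b, trapezoid 1 (1 / b) s *
          (s ^ 3 - max (s - 1) 0 ^ 3 - max (s - 1 / b) 0 ^ 3))
        - 6 * b ^ 2 * (∫ s in (0 : ℝ)..1 + 1 / b, trapezoid 1 (1 / b) s *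
          max (s - 1 / b) 0 ^ 2) - 2 := by
  have h1 : ∀ v : I, ∫ t : I, partialOne (copC b) t v ^ 2 =
      (fun s => b ^ 2 / 3 * (s ^ 3 - max (s - 1) 0 ^ 3 - max (s - 1 / b) 0 ^ 3)
        - b * max (s - 1 / b) 0 ^ 2) (sPar b v) := fun v => by
    simp only [partialOne_copC hb]
    rw [integral_coe_unitInterval fun t => clamp (b * (sPar b v - t)) 0 1 ^ 2]
    exact integral_clamp_sq hb (sPar_mem_Icc hb v)
  have hc := continuous_trapezoid 1 (1 / b)
  rw [chatterjeeXi]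
  simp only [h1]
  rw [integral_comp_sPar hb fun s => b ^ 2 / 3 * (s ^ 3 - max (s - 1) 0 ^ 3
      - max (s - 1 / b) 0 ^ 3) - b * max (s - 1 / b) 0 ^ 2]
  have h2 : ∀ s, b * (trapezoid 1 (1 / b) s * (b ^ 2 / 3 * (s ^ 3 - max (s - 1) 0 ^ 3
      - max (s - 1 / b) 0 ^ 3) - b * max (s - 1 / b) 0 ^ 2)) =
      b ^ 3 / 3 * (trapezoid 1 (1 / b) s * (s ^ 3 - max (s - 1) 0 ^ 3 - max (s - 1 / b) 0 ^ 3))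
        - b ^ 2 * (trapezoid 1 (1 / b) s * max (s - 1 / b) 0 ^ 2) := fun s => by ring
  simp only [h2]
  rw [intervalIntegral.integral_sub (Continuous.intervalIntegrable (by fun_prop) _ _)
    (Continuous.intervalIntegrable (by fun_prop) _ _), intervalIntegral.integral_const_mul,
    intervalIntegral.integral_const_mul]
  ring

lemma spearmanRho_copC_eq (hb : 0 < b) :
    spearmanRho (copC b) =
      6 * b ^ 2 * ((∫ s in (0 : ℝ)..1 + 1 / b, trapezoid 1 (1 / b) s * s ^ 2)
        - 1 / 3 * (∫ s in (0 : ℝ)..1 + 1 / b, trapezoid 1 (1 / b) s *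
          (s ^ 3 - max (s - 1) 0 ^ 3 - max (s - 1 / b) 0 ^ 3))
        - ∫ s in (0 : ℝ)..1 + 1 / b, trapezoid 1 (1 / b) s * max (s - 1 / b) 0 ^ 2) - 3 := by
  have h1 : ∀ v : I, ∫ u : I, copC b (u, v) =
      (fun s => b / 2 * (s ^ 2 - 1 / 3 * (s ^ 3 - max (s - 1) 0 ^ 3 - max (s - 1 / b) 0 ^ 3)
        - max (s - 1 / b) 0 ^ 2)) (sPar b v) := fun v => by
    simp only [copC_eq hb]
    rw [integral_coe_unitInterval]
    exact integral_rampIntegral (sPar_mem_Icc hb v)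
  have hc := continuous_trapezoid 1 (1 / b)
  have hint := (isCopula_copC hb).integrable
  rw [Measure.volume_eq_prod] at hint
  rw [spearmanRho, Measure.volume_eq_prod, integral_prod_symm _ hint]
  simp only [h1]
  rw [integral_comp_sPar hb fun s => b / 2 * (s ^ 2 - 1 / 3 * (s ^ 3 - max (s - 1) 0 ^ 3
    - max (s - 1 / b) 0 ^ 3) - max (s - 1 / b) 0 ^ 2)]
  have h2 : ∀ s, b * (trapezoid 1 (1 / b) s * (b / 2 * (s ^ 2 - 1 / 3 * (s ^ 3
      - max (s - 1) 0 ^ 3 - max (s - 1 / b) 0 ^ 3) - max (s - 1 / b) 0 ^ 2))) =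
      b ^ 2 / 2 * (trapezoid 1 (1 / b) s * s ^ 2 - 1 / 3 * (trapezoid 1 (1 / b) s *
        (s ^ 3 - max (s - 1) 0 ^ 3 - max (s - 1 / b) 0 ^ 3))
        - trapezoid 1 (1 / b) s * max (s - 1 / b) 0 ^ 2) := fun s => by ring
  simp only [h2]
  rw [intervalIntegral.integral_const_mul,
    intervalIntegral.integral_sub (Continuous.intervalIntegrable (by fun_prop) _ _)
      (Continuous.intervalIntegrable (by fun_prop) _ _),
    intervalIntegral.integral_sub (Continuous.intervalIntegrable (by fun_prop) _ _)
      (Continuous.intervalIntegrable (by fun_prop) _ _), intervalIntegral.integral_const_mul]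
  ring

lemma chatterjeeXi_copC_of_le_one (hb : 0 < b) (hb1 : b ≤ 1) :
    chatterjeeXi (copC b) = b ^ 2 / 2 - b ^ 3 / 5 := by
  have hr : 1 ≤ 1 / b := by rwa [le_div_iff₀ hb, one_mul]
  rw [chatterjeeXi_copC_eq hb, integral_trapezoid_mul_cubes zero_le_one hr,
    integral_trapezoid_mul_right_sq zero_le_one hr]
  field_simp
  ring

lemma spearmanRho_copC_of_le_one (hb : 0 < b) (hb1 : b ≤ 1) :
    spearmanRho (copC b) = b - 3 * b ^ 2 / 10 := by
  have hr : 1 ≤ 1 / b := by rwa [le_div_iff₀ hb, one_mul]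
  rw [spearmanRho_copC_eq hb, integral_trapezoid_mul_cubes zero_le_one hr,
    integral_trapezoid_mul_right_sq zero_le_one hr, integral_trapezoid_mul_sq zero_le_one hr]
  field_simp
  ring

lemma chatterjeeXi_copC_of_one_le (hb1 : 1 ≤ b) :
    chatterjeeXi (copC b) = 1 - 1 / b + 3 / (10 * b ^ 2) := by
  have hb : 0 < b := zero_lt_one.trans_le hb1
  have hr0 : 0 ≤ 1 / b := by positivity
  have hr : 1 / b ≤ 1 := by rwa [div_le_one hb]
  rw [chatterjeeXi_copC_eq hb]
  -- Now `1/b ≤ 1`, so the roles swap to `α = 1/b`, `β = 1`, and `max (s - 1/b) 0` is the left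
  -- positive part.
  simp only [trapezoid_comm 1, add_comm (1 : ℝ), sub_right_comm _ (max (_ - (1 : ℝ)) 0 ^ 3)]
  rw [integral_trapezoid_mul_cubes hr0 hr, integral_trapezoid_mul_left_sq hr0 hr]
  field_simp
  ring

lemma spearmanRho_copC_of_one_le (hb1 : 1 ≤ b) :
    spearmanRho (copC b) = 1 - 1 / (2 * b ^ 2) + 1 / (5 * b ^ 3) := by
  have hb : 0 < b := zero_lt_one.trans_le hb1
  have hr0 : 0 ≤ 1 / b := by positivity
  have hr : 1 / b ≤ 1 := by rwa [div_le_one hb]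
  rw [spearmanRho_copC_eq hb]
  simp only [trapezoid_comm 1, add_comm (1 : ℝ), sub_right_comm _ (max (_ - (1 : ℝ)) 0 ^ 3)]
  rw [integral_trapezoid_mul_cubes hr0 hr, integral_trapezoid_mul_left_sq hr0 hr,
    integral_trapezoid_mul_sq hr0 hr]
  field_simp
  ring

/-! ### Inversion of `b ↦ ξ(C_b)` -/

/-- Trigonometric solution of the cubic: with `r = √(6x)`, `k = cos (θ/3)` and `β = r/(2k)`, the
triple-angle formula becomes `4k² = 3 - 6β/5`, and `6x = r² = 4k²β²`. -/
lemma bPar_spec_of_le {x : ℝ} (hx0 : 0 < x) (hx : x ≤ 3 / 10) :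
    0 < bPar x ∧ bPar x ≤ 1 ∧ bPar x ^ 2 / 2 - bPar x ^ 3 / 5 = x := by
  have hr0 : 0 < √(6 * x) := Real.sqrt_pos.2 (by linarith)
  have hr2 : √(6 * x) ^ 2 = 6 * x := Real.sq_sqrt (by linarith)
  rw [bPar, if_pos hx]
  set r := √(6 * x)
  have hr1 : r ≤ 3 / 2 := by nlinarith
  set θ := Real.arccos (-(3 * r / 5)) with hθ
  have hcos : Real.cos θ = -(3 * r / 5) := Real.cos_arccos (by linarith) (by linarith)
  have htriple := Real.cos_three_mul (1 / 3 * θ)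
  rw [show 3 * (1 / 3 * θ) = θ by ring, hcos] at htriple
  have hpi := Real.pi_pos
  have hθ0 : 0 ≤ θ := Real.arccos_nonneg _
  have hθ1 : θ ≤ Real.pi := Real.arccos_le_pi _
  -- `θ/3 ≤ π/3` bounds `k` away from `0` and selects a root `β ≤ r ≤ 3/2`.
  have hhalf : 1 / 2 ≤ Real.cos (1 / 3 * θ) := by
    rw [← Real.cos_pi_div_three]
    exact Real.cos_le_cos_of_nonneg_of_le_pi (by linarith) (by linarith) (by linarith)
  set k := Real.cos (1 / 3 * θ)
  have hk0 : 0 < k := by linarith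
  have hb0 : 0 < r / (2 * k) := by positivity
  have hbr : r / (2 * k) ≤ 3 / 2 := by
    rw [div_le_iff₀ (by positivity)]
    linarith
  have hrk : r = r / (2 * k) * (2 * k) := by field_simp
  set β := r / (2 * k)
  have heq : β ^ 2 / 2 - β ^ 3 / 5 = x := by
    have h1 : k * (4 * k ^ 2 - 3 + 6 / 5 * β) = 0 := by
      linear_combination -htriple - 3 / 5 * hrk
    have h2 : 4 * k ^ 2 = 3 - 6 / 5 * β := by
      have := (mul_eq_zero.1 h1).resolve_left hk0.ne'
      linarith
    have h3 : 6 * x = β ^ 2 * (4 * k ^ 2) := by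
      rw [← hr2]
      nth_rewrite 1 [hrk]
      ring
    rw [h2] at h3
    linarith
  refine ⟨hb0, ?_, heq⟩
  -- The cubic equals `3/10` at `1`, and its excess over `3/10` is `(β - 1)(3 + 3β - 2β²)/10`,
  -- positive for `1 < β ≤ 3/2`.
  by_contra! hlt
  nlinarith [mul_pos (sub_pos.2 hlt) (show 0 < 3 + 3 * β - 2 * β ^ 2 by nlinarith)]

lemma bPar_spec_of_lt {x : ℝ} (hx : 3 / 10 < x) (hx1 : x < 1) :
    1 ≤ bPar x ∧ 1 - 1 / bPar x + 3 / (10 * bPar x ^ 2) = x := by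
  have hq2 : √(5 * (6 * x - 1)) ^ 2 = 5 * (6 * x - 1) := Real.sq_sqrt (by linarith)
  have hq : 2 ≤ √(5 * (6 * x - 1)) := Real.le_sqrt_of_sq_le (by linarith)
  rw [bPar, if_neg hx.not_ge]
  set q := √(5 * (6 * x - 1))
  have hy : 0 < 10 * (1 - x) := by linarith
  have hb1 : 1 ≤ (5 + q) / (10 * (1 - x)) := by
    rw [le_div_iff₀ hy]
    linarith
  refine ⟨hb1, ?_⟩
  have hmul : (5 + q) / (10 * (1 - x)) * (10 * (1 - x)) = 5 + q :=
    div_mul_cancel₀ _ hy.ne'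
  set β := (5 + q) / (10 * (1 - x))
  have hβ : 0 < β := by linarith
  -- Squaring `q = 10 (1 - x) β - 5` yields the quadratic for `β` times the nonzero factor `1 - x`.
  have h1 : (1 - x) * (10 * (1 - x) * β ^ 2 - 10 * β + 3) = 0 := by
    have : q = β * (10 * (1 - x)) - 5 := by linarith
    rw [this] at hq2
    linarith
  have h2 := (mul_eq_zero.1 h1).resolve_left (by linarith)
  field_simp
  linarith

lemma bPar_pos {c : ℝ} (hc0 : 0 < c) (hc1 : c < 1) : 0 < bPar c := by
  rcases le_or_gt c (3 / 10) with h | h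
  · exact (bPar_spec_of_le hc0 h).1
  · exact zero_lt_one.trans_le (bPar_spec_of_lt h hc1).1

lemma chatterjeeXi_copC_bPar {c : ℝ} (hc0 : 0 < c) (hc1 : c < 1) :
    chatterjeeXi (copC (bPar c)) = c := by
  rcases le_or_gt c (3 / 10) with h | h
  · obtain ⟨h0, h1, h2⟩ := bPar_spec_of_le hc0 h
    rw [chatterjeeXi_copC_of_le_one h0 h1, h2]
  · obtain ⟨h1, h2⟩ := bPar_spec_of_lt h hc1
    rw [chatterjeeXi_copC_of_one_le h1, h2]

lemma spearmanRho_copC_bPar {c : ℝ} (hc0 : 0 < c) (hc1 : c < 1) :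
    spearmanRho (copC (bPar c)) = maxRho c := by
  rw [maxRho, if_neg hc0.ne']
  rcases le_or_gt c (3 / 10) with h | h
  · obtain ⟨h0, h1, -⟩ := bPar_spec_of_le hc0 h
    rw [if_pos h, spearmanRho_copC_of_le_one h0 h1]
  · rw [if_neg h.not_ge, if_pos hc1, spearmanRho_copC_of_one_le (bPar_spec_of_lt h hc1).1]

lemma isUniqueMaximizer_copC (hb : 0 < b) : IsUniqueMaximizer (chatterjeeXi (copC b)) (copC b) :=
  (isCopula_copC hb).isUniqueMaximizer_of_clamp hb (measurable_sPar hb) _ (abs_sPar_le hb)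
    (partialOne_copC hb)

end XiRho

end

theorem mainTheorem2 :
    -- for `b > 0`, `C_b` is an SI copula with clamped linear first partial derivative
    (∀ b : ℝ, 0 < b →
      XiRho.IsCopula (XiRho.copC b) ∧ XiRho.IsSI (XiRho.copC b) ∧
      ∀ t v : unitInterval,
        HasDerivWithinAt (XiRho.firstSection (XiRho.copC b) v)
          (XiRho.clamp (b * (XiRho.sPar b v - t)) 0 1) (Set.Icc 0 1) t) ∧
    -- the case `c ∈ (0,1)`
    (∀ c : ℝ, 0 < c → c < 1 →
      0 < XiRho.bPar c ∧
      XiRho.IsUniqueMaximizer c (XiRho.copC (XiRho.bPar c)) ∧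
      XiRho.chatterjeeXi (XiRho.copC (XiRho.bPar c)) = c ∧
      XiRho.spearmanRho (XiRho.copC (XiRho.bPar c)) = XiRho.maxRho c) ∧
    -- the case `c = 0`
    (XiRho.IsUniqueMaximizer 0 XiRho.copPi ∧ XiRho.spearmanRho XiRho.copPi = XiRho.maxRho 0 ∧
      TendstoUniformly XiRho.copC XiRho.copPi (nhdsWithin 0 (Set.Ioi 0))) ∧
    -- the case `c = 1`
    (XiRho.IsUniqueMaximizer 1 XiRho.copM ∧ XiRho.spearmanRho XiRho.copM = XiRho.maxRho 1 ∧
      TendstoUniformly XiRho.copC XiRho.copM Filter.atTop) := by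
  refine ⟨fun b hb => ⟨XiRho.isCopula_copC hb, XiRho.isSI_copC hb,
      XiRho.hasDerivWithinAt_firstSection_copC hb⟩,
    fun c hc0 hc1 => ⟨XiRho.bPar_pos hc0 hc1, ?_, XiRho.chatterjeeXi_copC_bPar hc0 hc1,
      XiRho.spearmanRho_copC_bPar hc0 hc1⟩,
    ⟨XiRho.isUniqueMaximizer_copPi, ?_, XiRho.tendstoUniformly_copC_copPi⟩,
    ⟨XiRho.isUniqueMaximizer_copM, ?_, XiRho.tendstoUniformly_copC_copM⟩⟩
  · have h := XiRho.isUniqueMaximizer_copC (XiRho.bPar_pos hc0 hc1)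
    rwa [XiRho.chatterjeeXi_copC_bPar hc0 hc1] at h
  · rw [XiRho.spearmanRho_copPi, XiRho.maxRho, if_pos rfl]
  · rw [XiRho.spearmanRho_copM, XiRho.maxRho, if_neg one_ne_zero, if_neg (by norm_num),
      if_neg (lt_irrefl 1)]
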